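/- **Model.** A typical user sits at the origin of $\mathbb R^2$. There are three tiers of base stations: F-APs with the requested content ($F_c$), F-APs without it ($\tilde F_c$), and RRHs ($R$). They form independent homogeneous Poisson point processes $\Phi_{F_c},\Phi_{\tilde F_c},\Phi_R$ with densities $\lambda_{F_c}=p_{hit}\lambda_F$, $\lambda_{\tilde F_c}=(1-p_{hit})\lambda_F$ and $\lambda_R$, where $\lambda_F,\lambda_R>0$ and $p_{hit}\in[0,1]$. The transmit powers are $P_{F_c}=P_{\tilde F_c}=P_F>0$ and $P_R>0$, the path loss exponent is $\alpha>2$, and the channel gains $|h_x|^2$ are i.i.d. $\mathrm{Exp}(1)$, independent of the locations. With $B\ge 0$ feedback bits and $N_B\ge 2$ antennas at each RRH put $\zeta=1-2^B\,\mathrm{B}\big(2^B,\tfrac{N_B}{N_B-1}\big)$ (with $\mathrm B$ the Beta function) and $\upsilon=2^{-B/(N_B-1)}$. Write $r_x$ for the distance of $x$ from the origin and $g_x=P_i|h_x|^2r_x^{-\alpha}$ for $x\in\Phi_i$. In the interference-limited case (no noise) the SINR of the user at $x$ is $$\gamma_x=\frac{g_x}{\sum_{z\in\Phi_{F_c}\cup\Phi_{\tilde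 F_c}\cup\Phi_R,\ z\ne x}g_z}\quad (x\in\Phi_{F_c}\cup\Phi_{\tilde F_c}),\qquad \gamma_x=\frac{\zeta g_x}{\sum_{z\in\Phi_{F_c}\cup\Phi_{\tilde F_c}}g_z+\upsilon\sum_{z\in\Phi_R,\ z\neq x}g_z}\quad (x\in\Phi_R).$$ **Delays.** A link of SINR $\gamma$ carries the rate $\varphi(\gamma)$, for a strictly increasing $\varphi:[0,\infty)\to\mathbb R$ (for instance $\varphi(\gamma)=\log_2(1+\gamma)$). The delivery latency at $x\in\Phi_i$ is $D_x=\frac{L}{\varphi(\gamma_x)-\rho'_i}+D_i$ if $\varphi(\gamma_x)>\rho'_i$, and $D_x=\infty$ otherwise. Here $L>0$ is the content length, $\rho'_i=N_i\xi L$ is the traffic of a base station of tier $i$ ($N_i$ users, each with request rate $\xi$), and $D_{F_c}=0$, $D_{\tilde F_c}=D_{back}$, $D_R=D_{front}$ are constants. Tier $i$ has the delay requirement $D_x<\beta_i$, where $\beta_i>D_i$, and the SINR threshold $\eta_i$ with $\varphi(\eta_i)=N_i\xi L+\frac{L}{\beta_i-D_i}$. Assume $\eta_{F_c},\eta_{\tilde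 F_c}>1$ and $\eta_R>\zeta/\upsilon$. **Definitions.** Let $S_j=\mathbb P\big(\bigcup_{x\in\Phi_j}\{D_x<\beta_j\}\big)$ be the successful delivery probability at tier $j$, and let $E=\bigcup_i\bigcup_{x\in\Phi_i}\{D_x<\beta_i\}$. Under the minimal delay association policy the user is associated, on $E$, with the base station of lowest delay among those that meet the requirement of their tier. Let $A_j$ be the conditional probability, given $E$, that this base station belongs to tier $j$. **Claim.** $\mathbb P(E)>0$, and for every $j\in\{F_c,\tilde F_c,R\}$ $$A_j=\frac{\mathbb P\big(\bigcup_{x\in\Phi_j}\{D_x<\beta_j\}\big)}{\mathbb P(E)}=\frac{S_j}{S_{F_c}+S_{\tilde F_c}+S_R}.$$ Moreover, with $C(\alpha)=\frac{2\pi/\alpha}{\sin(2\pi/\alpha)}$, $$S_j=\frac{\lambda_jP_j^{2/\alpha}\eta_j^{-2/\alpha}}{C(\alpha)\sum_{i\in\{F_c,\tilde F_c,R\}}\lambda_iP_i^{2/\alpha}}\quad(j\in\{F_c,\tilde F_c\}),\qquad S_R=\frac{\lambda_R(\zeta P_R)^{2/\alpha}\eta_R^{-2/\alpha}}{C(\alpha)\big[\lambda_R(\upsilon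 P_R)^{2/\alpha}+\sum_{i\in\{F_c,\tilde F_c\}}\lambda_iP_i^{2/\alpha}\big]}.$$ -/

import Mathlib

open MeasureTheory ProbabilityTheory
open scoped ENNReal

/-- The Euclidean plane. -/
abbrev Plane : Type := EuclideanSpace ℝ (Fin 2)

/-- The three tiers of base stations: F-APs that hold the requested content (`Fc`), F-APs that
do not hold it (`Fn`), and RRHs (`R`). -/
inductive Tier : Type
  | Fc
  | Fn
  | R

section PointProcess

variable {Ω ι : Type*}

/-- The number of points of the enumerated point process `X` that lie in `A`. -/
noncomputable def pointCount (X : ι → Ω → Plane) (A : Set Plane) (ω : Ω) : ℕ∞ :=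
  Set.encard {n | X n ω ∈ A}

/-- `X` enumerates the points of a homogeneous Poisson point process of density `lam` in the
plane: the numbers of points in sets of finite area are Poisson distributed with mean
`lam * area`, and the numbers of points in disjoint sets are independent.
(The index set is infinite if `lam > 0`, and empty if `lam = 0`.) -/
structure IsPoissonProcess [MeasurableSpace Ω] (X : ι → Ω → Plane) (lam : ℝ)
    (μ : Measure Ω) : Prop where
  measurable : ∀ n, Measurable (X n)
  poisson : ∀ A : Set Plane, MeasurableSet A → volume A ≠ ∞ → ∀ k : ℕ,
    μ {ω | pointCount X A ω = (k : ℕ∞)} =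
      ENNReal.ofReal (Real.exp (-(lam * volume.real A)) * (lam * volume.real A) ^ k
        / (k.factorial : ℝ))
  indep : ∀ (m : ℕ) (A : Fin m → Set Plane), (∀ i, MeasurableSet (A i)) →
    (∀ i, volume (A i) ≠ ∞) → Pairwise (fun i j => Disjoint (A i) (A j)) →
    iIndepFun (fun i => pointCount X (A i)) μ

end PointProcess

/-- The numerical parameters of the network. -/
structure FRAN where
  /-- density of the F-APs -/
  lamF : ℝ
  /-- density of the RRHs -/
  lamR : ℝ
  /-- caching hit probability -/
  pHit : ℝ
  /-- transmit power of the F-APs -/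
  powF : ℝ
  /-- transmit power of the RRHs -/
  powR : ℝ
  /-- path loss exponent -/
  α : ℝ
  /-- noise variance -/
  noise : ℝ
  /-- number of feedback bits -/
  B : ℕ
  /-- number of antennas of an RRH -/
  NB : ℕ
  /-- length of a content -/
  L : ℝ
  /-- request rate of a user -/
  ξ : ℝ
  /-- number of users served by a base station of each tier -/
  N : Tier → ℝ
  /-- latency of the backhaul links -/
  Dback : ℝ
  /-- latency of the fronthaul links -/
  Dfront : ℝ
  /-- admissible delay in each tier -/
  β : Tier → ℝ

namespace FRAN

/-- The density of each tier. -/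
def lam (net : FRAN) : Tier → ℝ
  | .Fc => net.pHit * net.lamF
  | .Fn => (1 - net.pHit) * net.lamF
  | .R => net.lamR

/-- The transmit power in each tier. -/
def pow (net : FRAN) : Tier → ℝ
  | .Fc => net.powF
  | .Fn => net.powF
  | .R => net.powR

/-- The link latency in each tier, which adds to the queueing and transmission latency. -/
def linkLatency (net : FRAN) : Tier → ℝ
  | .Fc => 0
  | .Fn => net.Dback
  | .R => net.Dfront

/-- The quantized coefficient `ζ = 1 - K * Beta (K, N_B / (N_B - 1))` of a codebook of size
`K = 2 ^ B`. -/
noncomputable def ζ (net : FRAN) : ℝ :=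
  1 - (2 : ℝ) ^ net.B *
    ProbabilityTheory.beta ((2 : ℝ) ^ net.B) ((net.NB : ℝ) / ((net.NB : ℝ) - 1))

/-- The interference power coefficient `υ = 2 ^ (-B / (N_B - 1))`. -/
noncomputable def υ (net : FRAN) : ℝ :=
  (2 : ℝ) ^ (-((net.B : ℝ) / ((net.NB : ℝ) - 1)))

/-- The factor on the received power of the serving base station. -/
noncomputable def servingCoeff (net : FRAN) : Tier → ℝ
  | .R => net.ζ
  | _ => 1

/-- The factor on the power of an interferer of the second tier when the serving base station
belongs to the first tier. -/
noncomputable def interferenceCoeff (net : FRAN) : Tier → Tier → ℝ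
  | .R, .R => net.υ
  | _, _ => 1

/-- The traffic `N ξ L` of a base station of each tier. -/
noncomputable def traffic (net : FRAN) (j : Tier) : ℝ := net.N j * net.ξ * net.L

/-- The constant `C(α) = (2π/α) / sin (2π/α)`. -/
noncomputable def C (net : FRAN) : ℝ :=
  (2 * Real.pi / net.α) / Real.sin (2 * Real.pi / net.α)

section Model

variable {Ω : Type*} {ι : Tier → Type*}

/-- The random model: the base stations of the tiers form independent homogeneous Poisson point
processes with the densities of the network; the channel gains `h` (squared moduli of Rayleigh
fading coefficients) are i.i.d. exponential with mean `1` and independent of the locations. -/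
structure IsModel [MeasurableSpace Ω] (net : FRAN) (X : (j : Tier) → ι j → Ω → Plane)
    (h : (j : Tier) → ι j → Ω → ℝ) (μ : Measure Ω) : Prop where
  poisson : ∀ j, IsPoissonProcess (X j) (net.lam j) μ
  indep_tiers : iIndepFun (fun j ω (n : ι j) => X j n ω) μ
  measurable_gain : ∀ j n, Measurable (h j n)
  law_gain : ∀ j n, μ.map (h j n) = expMeasure 1
  indep_gain : iIndepFun (fun (b : Σ j, ι j) => h b.1 b.2) μ
  indep_gain_location :
    IndepFun (fun ω (b : Σ j, ι j) => X b.1 b.2 ω) (fun ω (b : Σ j, ι j) => h b.1 b.2 ω) μ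

/-- The power received from base station `b` by the typical user, who sits at the origin. -/
noncomputable def received (net : FRAN) (X : (j : Tier) → ι j → Ω → Plane)
    (h : (j : Tier) → ι j → Ω → ℝ) (b : Σ j, ι j) (ω : Ω) : ℝ :=
  net.pow b.1 * h b.1 b.2 ω * ‖X b.1 b.2 ω‖ ^ (-net.α)

/-- The total interference at the typical user when served by base station `b`. -/
noncomputable def interference (net : FRAN) (X : (j : Tier) → ι j → Ω → Plane)
    (h : (j : Tier) → ι j → Ω → ℝ) (b : Σ j, ι j) (ω : Ω) : ℝ≥0∞ :=
  ∑' c : {c : Σ j, ι j // c ≠ b},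
    ENNReal.ofReal (net.interferenceCoeff b.1 c.1.1 * net.received X h c.1 ω)

/-- The signal to interference plus noise ratio of the typical user at base station `b`. -/
noncomputable def sinr (net : FRAN) (X : (j : Tier) → ι j → Ω → Plane)
    (h : (j : Tier) → ι j → Ω → ℝ) (b : Σ j, ι j) (ω : Ω) : ℝ≥0∞ :=
  ENNReal.ofReal (net.servingCoeff b.1 * net.received X h b ω) /
    (net.interference X h b ω + ENNReal.ofReal net.noise)

open Classical in
/-- The delivery latency of the typical user at base station `b`, where a link of signal to
interference plus noise ratio `γ` carries the rate `rate γ`: the queueing and transmission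
latency `L / (rate - traffic)` plus the link latency. It is infinite if the queue is
overloaded. -/
noncomputable def delay (net : FRAN) (rate : ℝ → ℝ) (X : (j : Tier) → ι j → Ω → Plane)
    (h : (j : Tier) → ι j → Ω → ℝ) (b : Σ j, ι j) (ω : Ω) : EReal :=
  if net.traffic b.1 < rate (net.sinr X h b ω).toReal then
    ((net.L / (rate (net.sinr X h b ω).toReal - net.traffic b.1) + net.linkLatency b.1 : ℝ) :
      EReal)
  else ⊤

/-- The event that some base station of tier `j` meets the delay requirement of its tier. -/
def successEvent (net : FRAN) (rate : ℝ → ℝ) (X : (j : Tier) → ι j → Ω → Plane)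
    (h : (j : Tier) → ι j → Ω → ℝ) (j : Tier) : Set Ω :=
  ⋃ n : ι j, {ω | net.delay rate X h ⟨j, n⟩ ω < (net.β j : EReal)}

/-- The successful delivery probability `S_j` of the typical user at tier `j`. -/
noncomputable def successProb [MeasurableSpace Ω] (net : FRAN) (rate : ℝ → ℝ)
    (X : (j : Tier) → ι j → Ω → Plane) (h : (j : Tier) → ι j → Ω → ℝ) (μ : Measure Ω)
    (j : Tier) : ℝ :=
  μ.real (net.successEvent rate X h j)

/-- The probability that some base station of some tier meets its delay requirement. -/
noncomputable def totalSuccessProb [MeasurableSpace Ω] (net : FRAN) (rate : ℝ → ℝ)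
    (X : (j : Tier) → ι j → Ω → Plane) (h : (j : Tier) → ι j → Ω → ℝ) (μ : Measure Ω) : ℝ :=
  μ.real (⋃ j, net.successEvent rate X h j)

/-- The event that the minimal delay association policy associates the typical user with tier
`j`: some base station of tier `j` meets the delay requirement of its tier, with the lowest delay
among all the base stations that meet the requirement of their tier. -/
def assocEvent (net : FRAN) (rate : ℝ → ℝ) (X : (j : Tier) → ι j → Ω → Plane)
    (h : (j : Tier) → ι j → Ω → ℝ) (j : Tier) : Set Ω :=
  {ω | ∃ n : ι j, net.delay rate X h ⟨j, n⟩ ω < (net.β j : EReal) ∧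
    ∀ c : Σ i, ι i, net.delay rate X h c ω < (net.β c.1 : EReal) →
      net.delay rate X h ⟨j, n⟩ ω ≤ net.delay rate X h c ω}

/-- The association probability `A_j` of tier `j` under the minimal delay association policy,
given that some base station meets its delay requirement (the association event is contained in
that event). -/
noncomputable def assocProb [MeasurableSpace Ω] (net : FRAN) (rate : ℝ → ℝ)
    (X : (j : Tier) → ι j → Ω → Plane) (h : (j : Tier) → ι j → Ω → ℝ) (μ : Measure Ω)
    (j : Tier) : ℝ :=
  μ.real (net.assocEvent rate X h j) / net.totalSuccessProb rate X h μ

end Model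

end FRAN

/-! Since the rate is strictly increasing, a station meets its delay requirement exactly when its
SINR exceeds the threshold of its tier. The thresholds are so high that a station exceeding its own
is received with strictly more power than every other one (`received_lt_received`), so at most one
station qualifies (`eq_of_threshold_lt`). Minimizing the delay over the qualifying stations is then
vacuous: association events coincide with success events, these are disjoint, and $S_j$ is the
expected number of stations of tier $j$ above threshold.

That expectation is computed in two stages. Given the locations, the exponential tail of the serving
gain turns the probability that $b$ qualifies into $\exp(-\sum_{c\ne
b}\log(1+a_c\|X_b\|^\alpha\|X_c\|^{-\alpha}))$ (`measure_tsum_gain_lt_of_indepFun`). The sum over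
the points of tier $j$ is then averaged with the Mecke formula, which comes from differentiating the
Laplace functional (`laplace`, `mecke_family`, `reduced_mecke_family`). With $C(\alpha)$ supplied by
a planar integral and Euler's reflection formula, the result is $\lambda_j\int
e^{-k\|y\|^2}dy=\lambda_j\pi/k$, where $k=\pi C(\alpha)\sum_i\lambda_ia_i^{2/\alpha}$.

The Mecke formula proved here has a fixed function in the exponent, whereas the serving distance
$\|X_b\|$ is random. `lintegral_tsum_coverage` removes this gap: on thin geometric annuli the
distance is bracketed by the two radii, and their ratio tends to 1. -/

open Filter Topology

/-! ### The negative exponential on $[0,\infty]$ and its first-order behaviour at 0. -/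

/-- The function `x ↦ exp (-x)` on the extended nonnegative reals. -/
noncomputable def expNeg (x : ℝ≥0∞) : ℝ≥0∞ := EReal.exp (-(x : EReal))

@[simp] lemma expNeg_zero : expNeg 0 = 1 := by simp [expNeg]

@[simp] lemma expNeg_top : expNeg ∞ = 0 := by simp [expNeg]

lemma expNeg_ofReal {a : ℝ} (ha : 0 ≤ a) :
    expNeg (ENNReal.ofReal a) = ENNReal.ofReal (Real.exp (-a)) := by
  rw [expNeg, EReal.coe_ennreal_ofReal, max_eq_left ha, ← EReal.coe_neg, EReal.exp_coe]

lemma expNeg_add (x y : ℝ≥0∞) : expNeg (x + y) = expNeg x * expNeg y := by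
  rw [expNeg, EReal.coe_ennreal_add, EReal.neg_add, sub_eq_add_neg, EReal.exp_add]
  · rfl
  · left; simp
  · right; simp

lemma expNeg_antitone : Antitone expNeg := fun x y hxy => by
  unfold expNeg
  rw [EReal.exp_le_exp_iff, EReal.neg_le_neg_iff]
  exact_mod_cast hxy

lemma expNeg_le_one (x : ℝ≥0∞) : expNeg x ≤ 1 := by
  rw [← expNeg_zero]; exact expNeg_antitone zero_le

lemma expNeg_ne_top (x : ℝ≥0∞) : expNeg x ≠ ∞ := ne_top_of_le_ne_top ENNReal.one_ne_top
  (expNeg_le_one x)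

lemma continuous_expNeg : Continuous expNeg := by
  unfold expNeg
  have : Continuous EReal.exp := by fun_prop
  exact this.comp (continuous_neg.comp continuous_coe_ennreal_ereal)

lemma measurable_expNeg : Measurable expNeg := continuous_expNeg.measurable

@[fun_prop]
lemma Measurable.expNeg {α : Type*} [MeasurableSpace α] {f : α → ℝ≥0∞} (hf : Measurable f) :
    Measurable fun a => expNeg (f a) := measurable_expNeg.comp hf

lemma expNeg_sum {κ : Type*} (s : Finset κ) (f : κ → ℝ≥0∞) :
    expNeg (∑ i ∈ s, f i) = ∏ i ∈ s, expNeg (f i) := by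
  classical
  induction s using Finset.induction_on with
  | empty => simp
  | insert a s ha ih => rw [Finset.sum_insert ha, Finset.prod_insert ha, expNeg_add, ih]

lemma expNeg_nsmul (n : ℕ) (x : ℝ≥0∞) : expNeg (n * x) = expNeg x ^ n := by
  rw [← nsmul_eq_mul, ← Finset.card_range n, ← Finset.sum_const, expNeg_sum, Finset.prod_const]

lemma tendsto_expNeg_sum {κ : Type*} (f : κ → ℝ≥0∞) :
    Tendsto (fun s : Finset κ => ∏ i ∈ s, expNeg (f i)) atTop (𝓝 (expNeg (∑' i, f i))) := by
  simp_rw [← expNeg_sum]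
  exact (continuous_expNeg.tendsto _).comp ENNReal.summable.hasSum

lemma one_sub_expNeg_le (x : ℝ≥0∞) : 1 - expNeg x ≤ x := by
  induction x with
  | top => simp
  | coe x =>
    rw [← ENNReal.ofReal_coe_nnreal, expNeg_ofReal x.coe_nonneg, ← ENNReal.ofReal_one,
      ← ENNReal.ofReal_sub _ (Real.exp_pos _).le]
    apply ENNReal.ofReal_le_ofReal
    linarith [Real.add_one_le_exp (-(x : ℝ))]

/-- This is $1+x\le e^x$ multiplied by $e^{-x}$. Together with `one_sub_expNeg_le` it squeezes
$1-e^{-x}$ between two quantities asymptotic to $x$ at 0. -/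
lemma mul_expNeg_le (x : ℝ≥0∞) : x * expNeg x ≤ 1 - expNeg x := by
  induction x with
  | top => simp
  | coe x =>
    rw [← ENNReal.ofReal_coe_nnreal, expNeg_ofReal x.coe_nonneg, ← ENNReal.ofReal_one,
      ← ENNReal.ofReal_sub _ (Real.exp_pos _).le, ← ENNReal.ofReal_mul x.coe_nonneg]
    apply ENNReal.ofReal_le_ofReal
    have h1 := Real.add_one_le_exp (x : ℝ)
    have h2 : Real.exp (x : ℝ) * Real.exp (-(x : ℝ)) = 1 := by rw [← Real.exp_add]; simp
    nlinarith [Real.exp_pos (-(x : ℝ))]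

lemma one_sub_expNeg_add (x y : ℝ≥0∞) :
    1 - expNeg (x + y) = (1 - expNeg x) + expNeg x * (1 - expNeg y) := by
  rw [expNeg_add, ENNReal.mul_sub (fun _ _ => expNeg_ne_top x), mul_one]
  have h : expNeg x * expNeg y ≤ expNeg x := mul_le_of_le_one_right' (expNeg_le_one y)
  exact (tsub_add_tsub_cancel (expNeg_le_one x) h).symm

/-- If `m * y m → K < ∞` then `m * (1 - exp (- y m)) → K`. -/
lemma tendsto_natCast_mul_one_sub_expNeg {y : ℕ → ℝ≥0∞} {K : ℝ≥0∞} (hK : K ≠ ∞)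
    (hy : Tendsto (fun m : ℕ => (m : ℝ≥0∞) * y m) atTop (𝓝 K)) :
    Tendsto (fun m : ℕ => (m : ℝ≥0∞) * (1 - expNeg (y m))) atTop (𝓝 K) := by
  have hy0 : Tendsto y atTop (𝓝 0) := by
    have h1 : Tendsto (fun m : ℕ => ((m : ℝ≥0∞) * y m) * (m : ℝ≥0∞)⁻¹) atTop (𝓝 (K * 0)) :=
      ENNReal.Tendsto.mul hy (Or.inr (by simp)) ENNReal.tendsto_inv_nat_nhds_zero (Or.inr hK)
    rw [mul_zero] at h1
    refine h1.congr' ?_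
    filter_upwards [eventually_gt_atTop 0] with m hm
    rw [mul_comm, ← mul_assoc, ENNReal.inv_mul_cancel (by exact_mod_cast hm.ne') (by simp), one_mul]
  have h2 : Tendsto (fun m : ℕ => ((m : ℝ≥0∞) * y m) * expNeg (y m)) atTop (𝓝 (K * 1)) := by
    refine ENNReal.Tendsto.mul hy (Or.inr (by simp)) ?_ (Or.inr hK)
    rw [← expNeg_zero]
    exact (continuous_expNeg.tendsto 0).comp hy0
  rw [mul_one] at h2
  refine tendsto_of_tendsto_of_tendsto_of_le_of_le h2 hy (fun (m : ℕ) => ?_) fun (m : ℕ) => ?_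
  · change ((m : ℝ≥0∞) * y m) * expNeg (y m) ≤ (m : ℝ≥0∞) * (1 - expNeg (y m))
    rw [mul_assoc]
    exact mul_le_mul_right (mul_expNeg_le _) _
  · exact mul_le_mul_right (one_sub_expNeg_le _) _

lemma natCast_mul_one_sub_expNeg_le (m : ℕ) (x : ℝ≥0∞) :
    (m : ℝ≥0∞) * (1 - expNeg (x / m)) ≤ x := by
  refine (mul_le_mul_right (one_sub_expNeg_le _) _).trans ?_
  exact ENNReal.mul_div_le

lemma tendsto_natCast_mul_one_sub_expNeg_div (x : ℝ≥0∞) :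
    Tendsto (fun m : ℕ => (m : ℝ≥0∞) * (1 - expNeg (x / m))) atTop (𝓝 x) := by
  by_cases hx : x = ∞
  · subst hx
    have : Tendsto (fun m : ℕ => (m : ℝ≥0∞)) atTop (𝓝 ∞) := ENNReal.tendsto_nat_nhds_top
    refine this.congr fun m => ?_
    rw [ENNReal.top_div_of_ne_top (by simp)]; simp
  · refine tendsto_natCast_mul_one_sub_expNeg hx ?_
    refine tendsto_const_nhds.congr' ?_
    filter_upwards [eventually_gt_atTop 0] with m hm
    rw [ENNReal.mul_div_cancel (by exact_mod_cast hm.ne') (by simp)]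

/-- The derivative at 0 that turns Laplace functionals into Mecke formulas. Fatou gives the lower
bound and $m(1-e^{-V/m})\le V$ the upper one, so no integrability is needed and the limit may be
infinite. -/
lemma tendsto_lintegral_mul_one_sub_expNeg {α : Type*} [MeasurableSpace α] (ν : Measure α)
    {W V : α → ℝ≥0∞} (hW : Measurable W) (hV : Measurable V) :
    Tendsto (fun m : ℕ => (m : ℝ≥0∞) * ∫⁻ a, W a * (1 - expNeg (V a / m)) ∂ν) atTop
      (𝓝 (∫⁻ a, W a * V a ∂ν)) := by
  have hm : ∀ m : ℕ, Measurable fun a => W a * ((m : ℝ≥0∞) * (1 - expNeg (V a / m))) := by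
    intro m; fun_prop
  have heq : ∀ m : ℕ, (m : ℝ≥0∞) * ∫⁻ a, W a * (1 - expNeg (V a / m)) ∂ν
      = ∫⁻ a, W a * ((m : ℝ≥0∞) * (1 - expNeg (V a / m))) ∂ν := by
    intro m
    rw [← lintegral_const_mul _ (by fun_prop)]
    congr 1; ext a; ring
  simp_rw [heq]
  refine tendsto_of_le_liminf_of_limsup_le ?_ ?_
  · refine le_trans (lintegral_mono fun a => ?_) (lintegral_liminf_le hm)
    -- Zero factors are treated apart because multiplication on $[0,\infty]$ is discontinuous at
    -- $(0,\infty)$ and $(\infty,0)$.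
    by_cases hWa : W a = 0
    · simp [hWa]
    by_cases hVa : V a = 0
    · simp [hVa]
    refine (Tendsto.liminf_eq ?_).ge
    exact ENNReal.Tendsto.mul tendsto_const_nhds (Or.inl hWa)
      (tendsto_natCast_mul_one_sub_expNeg_div _) (Or.inl hVa)
  · refine limsup_le_of_le (h := Eventually.of_forall fun m => lintegral_mono fun a => ?_)
    exact mul_le_mul_right (natCast_mul_one_sub_expNeg_le _ _) _

/-! ### The Laplace functional of one Poisson process. -/

section PoissonLaplace

lemma lintegral_expNeg_mul_poissonMeasure (r : NNReal) (a : ℝ≥0∞) :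
    ∫⁻ n : ℕ, expNeg (a * n) ∂(poissonMeasure r) = expNeg (r * (1 - expNeg a)) := by
  obtain ⟨q, hq⟩ : ∃ q : NNReal, expNeg a = q :=
    ⟨(expNeg a).toNNReal, (ENNReal.coe_toNNReal (expNeg_ne_top a)).symm⟩
  have hq1 : (q : ℝ) ≤ 1 := by
    have := expNeg_le_one a
    rw [hq] at this
    exact_mod_cast this
  have h1 : ∀ n : ℕ, expNeg (a * n) = ENNReal.ofReal ((q : ℝ) ^ n) := by
    intro n
    rw [mul_comm, expNeg_nsmul, hq, ENNReal.ofReal_pow q.coe_nonneg, ENNReal.ofReal_coe_nnreal]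
  simp_rw [h1]
  rw [poissonMeasure, lintegral_sum_measure]
  simp only [lintegral_smul_measure, lintegral_dirac, smul_eq_mul]
  have h2 : ∀ n : ℕ, ENNReal.ofReal (Real.exp (-r) * r ^ n / (n.factorial : ℝ))
      * ENNReal.ofReal ((q : ℝ) ^ n)
      = ENNReal.ofReal (Real.exp (-r) * ((r * q : ℝ) ^ n / (n.factorial : ℝ))) := by
    intro n
    rw [← ENNReal.ofReal_mul (by positivity)]
    congr 1; rw [mul_pow]; ring
  simp_rw [h2]
  have h3 := (NormedSpace.expSeries_div_hasSum_exp (r * q : ℝ)).mul_left (Real.exp (-r))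
  rw [← ENNReal.ofReal_tsum_of_nonneg (fun n => by positivity) h3.summable, h3.tsum_eq,
    ← Real.exp_eq_exp_ℝ, ← Real.exp_add]
  have h4 : (r : ℝ≥0∞) * (1 - expNeg a) = ENNReal.ofReal (r * (1 - q)) := by
    rw [ENNReal.ofReal_mul r.coe_nonneg, ENNReal.ofReal_coe_nnreal,
      ENNReal.ofReal_sub _ q.coe_nonneg, ENNReal.ofReal_one, ENNReal.ofReal_coe_nnreal, hq]
  rw [h4, expNeg_ofReal (mul_nonneg r.coe_nonneg (by linarith))]
  congr 2; ring

/-- The Poisson weights already add up to 1, so no mass is left for the value $\infty$: an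
inequality between probability measures is an equality. -/
lemma eq_map_natCast_poissonMeasure (ν : Measure ℕ∞) [IsProbabilityMeasure ν] (r : NNReal)
    (h : ∀ k : ℕ, ν {(k : ℕ∞)} = poissonMeasure r {k}) :
    ν = (poissonMeasure r).map (fun n : ℕ => (n : ℕ∞)) := by
  symm
  have : IsProbabilityMeasure ((poissonMeasure r).map (fun n : ℕ => (n : ℕ∞))) :=
    Measure.isProbabilityMeasure_map Measurable.of_discrete.aemeasurable
  refine Measure.eq_of_le_of_isProbabilityMeasure ?_
  refine Measure.le_iff.2 fun s _ => ?_
  rw [Measure.map_apply .of_discrete .of_discrete]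
  have hU : (fun n : ℕ => (n : ℕ∞)) ⁻¹' s = ⋃ k ∈ {k : ℕ | (k : ℕ∞) ∈ s}, {k} := by ext; simp
  have hV : (⋃ k ∈ {k : ℕ | (k : ℕ∞) ∈ s}, {(k : ℕ∞)}) ⊆ s := by
    intro x hx
    simp only [Set.mem_ofPred_eq, Set.mem_iUnion, Set.mem_singleton_iff, exists_prop] at hx
    obtain ⟨k, hk, rfl⟩ := hx
    exact hk
  refine le_trans (le_of_eq ?_) (measure_mono hV)
  rw [hU, measure_biUnion (Set.to_countable _) _ (fun _ _ => .of_discrete),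
    measure_biUnion (Set.to_countable _) _ (fun _ _ => .of_discrete)]
  · simp_rw [h]
  · intro i _ j _ hij; simpa [Function.onFun] using hij
  · intro i _ j _ hij; simpa [Function.onFun] using hij

lemma pointCount_eq_tsum {Ω ι : Type*} (X : ι → Ω → Plane) (A : Set Plane) (ω : Ω) :
    ((pointCount X A ω : ℕ∞) : ℝ≥0∞) = ∑' n, A.indicator (fun _ => (1 : ℝ≥0∞)) (X n ω) := by
  rw [pointCount, ← ENNReal.tsum_set_one, tsum_subtype {n | X n ω ∈ A} fun _ => (1 : ℝ≥0∞)]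
  rfl

variable {Ω ι : Type*} [MeasurableSpace Ω]

lemma measurable_pointCount [Countable ι] {X : ι → Ω → Plane} (hX : ∀ n, Measurable (X n))
    {A : Set Plane} (hA : MeasurableSet A) : Measurable (pointCount X A) := by
  refine measurable_encard.comp ?_
  rw [measurable_set_iff]
  exact fun n => (hX n hA).mem

namespace IsPoissonProcess

variable {μ : Measure Ω} [IsProbabilityMeasure μ] [Countable ι] {X : ι → Ω → Plane} {lam : ℝ}

lemma lintegral_expNeg_mul_pointCount (hX : IsPoissonProcess X lam μ) (hlam : 0 ≤ lam)
    {A : Set Plane} (hA : MeasurableSet A) (hA' : volume A ≠ ∞) (a : ℝ≥0∞) :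
    ∫⁻ ω, expNeg (a * (pointCount X A ω : ℕ∞)) ∂μ
      = expNeg (ENNReal.ofReal lam * ((1 - expNeg a) * volume A)) := by
  have hm := measurable_pointCount hX.measurable hA
  obtain ⟨r, hr⟩ : ∃ r : NNReal, (r : ℝ) = lam * volume.real A :=
    ⟨⟨lam * volume.real A, mul_nonneg hlam measureReal_nonneg⟩, rfl⟩
  have : IsProbabilityMeasure (μ.map (pointCount X A)) :=
    Measure.isProbabilityMeasure_map hm.aemeasurable
  have hν := eq_map_natCast_poissonMeasure (μ.map (pointCount X A)) r (fun k => by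
    rw [Measure.map_apply hm .of_discrete, poissonMeasure_singleton, hr]
    exact hX.poisson A hA hA' k)
  have h1 := lintegral_map (μ := μ) (g := pointCount X A)
    (f := fun k : ℕ∞ => expNeg (a * (k : ℝ≥0∞))) .of_discrete hm
  rw [← h1, hν, lintegral_map .of_discrete .of_discrete]
  simp only [ENat.toENNReal_coe]
  rw [lintegral_expNeg_mul_poissonMeasure]
  have : (r : ℝ≥0∞) = ENNReal.ofReal lam * volume A := by
    rw [← ENNReal.ofReal_coe_nnreal, hr, ENNReal.ofReal_mul hlam, measureReal_def,
      ENNReal.ofReal_toReal hA']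
  rw [this]
  congr 1; ring

/-- The sum over the points is a linear combination of independent Poisson counts, so the
expectation factors into Poisson generating functions. By disjointness $1-e^{-u}$ is again a step
function on the same sets. -/
lemma laplace_step (hX : IsPoissonProcess X lam μ) (hlam : 0 ≤ lam) (m : ℕ)
    (A : Fin m → Set Plane) (hA : ∀ i, MeasurableSet (A i)) (hA' : ∀ i, volume (A i) ≠ ∞)
    (hd : Pairwise fun i j => Disjoint (A i) (A j)) (a : Fin m → ℝ≥0∞) (u : Plane → ℝ≥0∞)
    (hu : ∀ y, u y = ∑ i, a i * (A i).indicator (fun _ => (1 : ℝ≥0∞)) y) :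
    ∫⁻ ω, expNeg (∑' n, u (X n ω)) ∂μ
      = expNeg (ENNReal.ofReal lam * ∫⁻ y, (1 - expNeg (u y))) := by
  have h1 : ∀ ω, ∑' n, u (X n ω) = ∑ i, a i * (pointCount X (A i) ω : ℕ∞) := by
    intro ω
    simp_rw [hu, pointCount_eq_tsum, ← ENNReal.tsum_mul_left]
    exact Summable.tsum_finsetSum fun i _ => ENNReal.summable
  simp_rw [h1, expNeg_sum]
  have hind := (hX.indep m A hA hA' hd).comp
    (fun i (k : ℕ∞) => expNeg (a i * (k : ℝ≥0∞))) (fun i => .of_discrete)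
  have h2 := lintegral_prod_eq_prod_lintegral_of_indepFun Finset.univ _ hind (fun i =>
    Measurable.of_discrete.comp (measurable_pointCount hX.measurable (hA i)))
  simp only [Function.comp_apply] at h2
  rw [h2]
  simp_rw [hX.lintegral_expNeg_mul_pointCount hlam (hA _) (hA' _)]
  rw [← expNeg_sum, ← Finset.mul_sum]
  have h3 : ∀ y, 1 - expNeg (u y) = ∑ i, (A i).indicator (fun _ => 1 - expNeg (a i)) y := by
    intro y
    rw [hu]
    by_cases hy : ∃ i, y ∈ A i
    · obtain ⟨i, hi⟩ := hy
      have hne : ∀ j, j ≠ i → y ∉ A j := fun j hj hyj =>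
        Set.disjoint_left.1 (hd hj) hyj hi
      rw [Finset.sum_eq_single i, Finset.sum_eq_single i]
      · simp [hi]
      · intro j _ hj; simp [hne j hj]
      · simp
      · intro j _ hj; simp [hne j hj]
      · simp
    · push Not at hy
      simp [hy]
  simp_rw [h3]
  rw [lintegral_finsetSum _ fun i _ => measurable_const.indicator (hA i)]
  simp_rw [lintegral_indicator (hA _), setLIntegral_const]

lemma laplace_simpleFunc (hX : IsPoissonProcess X lam μ) (hlam : 0 ≤ lam)
    (u : SimpleFunc Plane ℝ≥0∞) (hu : ∀ a, a ≠ 0 → volume (u ⁻¹' {a}) ≠ ∞) :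
    ∫⁻ ω, expNeg (∑' n, u (X n ω)) ∂μ
      = expNeg (ENNReal.ofReal lam * ∫⁻ y, (1 - expNeg (u y))) := by
  classical
  set s := u.range.erase 0 with hs
  let e := s.equivFin.symm
  refine hX.laplace_step hlam s.card (fun i => u ⁻¹' {(e i : ℝ≥0∞)})
    (fun i => u.measurableSet_fiber _) (fun i => hu _ (Finset.ne_of_mem_erase (e i).2))
    (fun i j hij => ?_) (fun i => (e i : ℝ≥0∞)) u fun y => ?_
  · refine Set.disjoint_left.2 fun y hy hy' => ?_
    simp only [Set.mem_preimage, Set.mem_singleton_iff] at hy hy'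
    exact hij (e.injective (Subtype.ext (hy.symm.trans hy')))
  · rw [Equiv.sum_comp e (fun b : s => (b : ℝ≥0∞) *
      (u ⁻¹' {(b : ℝ≥0∞)}).indicator (fun _ => (1 : ℝ≥0∞)) y)]
    rw [Finset.sum_coe_sort s (fun b => b * (u ⁻¹' {b}).indicator (fun _ => (1 : ℝ≥0∞)) y)]
    by_cases hy : u y = 0
    · rw [hy, Finset.sum_eq_zero]
      intro b hb
      have : u y ≠ b := by rw [hy]; exact (Finset.ne_of_mem_erase hb).symm
      simp [this]
    · rw [Finset.sum_eq_single (u y)]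
      · simp
      · intro b _ hb
        simp [hb.symm]
      · intro h
        exact absurd (Finset.mem_erase.2 ⟨hy, u.mem_range_self y⟩) h

/-- The Laplace functional of a Poisson process. -/
theorem laplace (hX : IsPoissonProcess X lam μ) (hlam : 0 ≤ lam) {u : Plane → ℝ≥0∞}
    (hu : Measurable u) :
    ∫⁻ ω, expNeg (∑' n, u (X n ω)) ∂μ
      = expNeg (ENNReal.ofReal lam * ∫⁻ y, (1 - expNeg (u y))) := by
  -- Restricting to balls of radius $k$ gives every nonzero level set finite area, as the counting
  -- axioms require.
  set v : ℕ → SimpleFunc Plane ℝ≥0∞ := fun k =>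
    (SimpleFunc.eapprox u k).restrict (Metric.ball 0 k) with hv
  have hv_apply : ∀ k y, v k y
      = (Metric.ball (0 : Plane) k).indicator (SimpleFunc.eapprox u k) y := fun k y => by
    rw [hv]; exact SimpleFunc.restrict_apply _ measurableSet_ball _
  have hmono : ∀ y, Monotone fun k => v k y := by
    intro y k l hkl
    simp only [hv_apply]
    refine (Set.indicator_le_indicator (SimpleFunc.monotone_eapprox u hkl y)).trans ?_
    exact Set.indicator_le_indicator_of_subset
      (Metric.ball_subset_ball (by exact_mod_cast hkl)) (fun _ => zero_le) y
  have htend : ∀ y, Tendsto (fun k => v k y) atTop (𝓝 (u y)) := by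
    intro y
    refine (SimpleFunc.tendsto_eapprox hu y).congr' ?_
    obtain ⟨K, hK⟩ := exists_nat_gt ‖y‖
    filter_upwards [eventually_ge_atTop K] with k hk
    have : y ∈ Metric.ball (0 : Plane) k := by
      rw [mem_ball_zero_iff]; exact hK.trans_le (by exact_mod_cast hk)
    rw [hv_apply, Set.indicator_of_mem this]
  have hstep : ∀ k, ∫⁻ ω, expNeg (∑' n, v k (X n ω)) ∂μ
      = expNeg (ENNReal.ofReal lam * ∫⁻ y, (1 - expNeg (v k y))) := by
    intro k
    refine hX.laplace_simpleFunc hlam (v k) fun a ha => ?_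
    refine measure_ne_top_of_subset (s := Metric.ball (0 : Plane) k) (fun y hy => ?_)
      (measure_ball_lt_top (μ := volume)).ne
    by_contra hyk
    rw [Set.mem_preimage, hv_apply, Set.indicator_of_notMem hyk] at hy
    exact ha hy.symm
  have hsum : ∀ ω, Tendsto (fun k => ∑' n, v k (X n ω)) atTop (𝓝 (∑' n, u (X n ω))) := by
    intro ω
    have hsup : ∑' n, u (X n ω) = ⨆ k, ∑' n, v k (X n ω) := by
      -- Monotone convergence for the sum over points, read as an integral against counting measure.
      let _ : MeasurableSpace ι := ⊤
      simp_rw [← lintegral_count]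
      rw [← lintegral_iSup (fun k => .of_discrete) (fun k l hkl n => hmono (X n ω) hkl)]
      congr 1; ext n
      exact (iSup_eq_of_tendsto (hmono _) (htend _)).symm
    rw [hsup]
    exact tendsto_atTop_iSup fun k l hkl => ENNReal.tsum_le_tsum fun n => hmono _ hkl
  have hL : Tendsto (fun k => ∫⁻ ω, expNeg (∑' n, v k (X n ω)) ∂μ) atTop
      (𝓝 (∫⁻ ω, expNeg (∑' n, u (X n ω)) ∂μ)) := by
    refine tendsto_lintegral_of_dominated_convergence (fun _ => 1) (fun k => ?_) (fun k => ?_)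
      (by simp) ?_
    · exact (Measurable.tsum fun n =>
        (v k).measurable.comp (hX.measurable n)).expNeg
    · exact .of_forall fun ω => expNeg_le_one _
    · exact .of_forall fun ω => (continuous_expNeg.tendsto _).comp (hsum ω)
  have hI : Tendsto (fun k => ∫⁻ y, (1 - expNeg (v k y))) atTop
      (𝓝 (∫⁻ y, (1 - expNeg (u y)))) := by
    refine lintegral_tendsto_of_tendsto_of_monotone (fun k => ?_) ?_ ?_
    · exact (measurable_const.sub (v k).measurable.expNeg).aemeasurable
    · exact .of_forall fun y k l hkl =>
        tsub_le_tsub_left (expNeg_antitone (hmono y hkl)) 1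
    · refine .of_forall fun y => ?_
      exact ENNReal.Tendsto.sub tendsto_const_nhds
        ((continuous_expNeg.tendsto _).comp (htend y)) (Or.inl ENNReal.one_ne_top)
  refine tendsto_nhds_unique hL ?_
  simp_rw [hstep]
  exact (continuous_expNeg.tendsto _).comp
    (ENNReal.Tendsto.const_mul hI (Or.inr ENNReal.ofReal_ne_top))

end IsPoissonProcess

end PoissonLaplace

/-! ### Independent Poisson processes and the Mecke formula. -/

section PoissonFamily

variable {Ω T : Type*} [MeasurableSpace Ω] [Fintype T] {ι : T → Type*} [∀ j, Countable (ι j)]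
  {μ : Measure Ω} [IsProbabilityMeasure μ] {X : (j : T) → ι j → Ω → Plane} {lam : T → ℝ}

/-- The Laplace functional of a finite family of independent Poisson processes. -/
theorem laplace_family (hX : ∀ j, IsPoissonProcess (X j) (lam j) μ)
    (hind : iIndepFun (fun j ω (n : ι j) => X j n ω) μ) (hlam : ∀ j, 0 ≤ lam j)
    {u : T → Plane → ℝ≥0∞} (hu : ∀ j, Measurable (u j)) :
    ∫⁻ ω, expNeg (∑' c : Σ j, ι j, u c.1 (X c.1 c.2 ω)) ∂μ
      = expNeg (∑ j, ENNReal.ofReal (lam j) * ∫⁻ y, (1 - expNeg (u j y))) := by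
  have hg : ∀ j, Measurable fun x : ι j → Plane => expNeg (∑' n, u j (x n)) := fun j =>
    (Measurable.tsum fun n => (hu j).comp (measurable_pi_apply n)).expNeg
  have hm : ∀ j, Measurable fun ω => fun n : ι j => X j n ω := fun j =>
    measurable_pi_lambda _ fun n => (hX j).measurable n
  have h2 := lintegral_prod_eq_prod_lintegral_of_indepFun Finset.univ _ (hind.comp _ hg)
    fun j => (hg j).comp (hm j)
  simp only [Function.comp_apply] at h2
  simp_rw [ENNReal.tsum_sigma', tsum_fintype, expNeg_sum]
  rw [h2]
  exact Finset.prod_congr rfl fun j _ => (hX j).laplace (hlam j) (hu j)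

/-- The multivariate Mecke formula for functionals of the form `φ (x) * exp (- ∑ u)`. -/
theorem mecke_family (hX : ∀ j, IsPoissonProcess (X j) (lam j) μ)
    (hind : iIndepFun (fun j ω (n : ι j) => X j n ω) μ) (hlam : ∀ j, 0 ≤ lam j)
    {u : T → Plane → ℝ≥0∞} (hu : ∀ j, Measurable (u j)) (j : T) {φ : Plane → ℝ≥0∞}
    (hφ : Measurable φ) (hfin : ∫⁻ y, expNeg (u j y) * φ y ≠ ∞) :
    ∫⁻ ω, expNeg (∑' c : Σ i, ι i, u c.1 (X c.1 c.2 ω)) * ∑' n, φ (X j n ω) ∂μ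
      = ENNReal.ofReal (lam j) * (∫⁻ y, expNeg (u j y) * φ y)
        * expNeg (∑ i, ENNReal.ofReal (lam i) * ∫⁻ y, (1 - expNeg (u i y))) := by
  classical
  set Z : Ω → ℝ≥0∞ := fun ω => ∑' c : Σ i, ι i, u c.1 (X c.1 c.2 ω) with hZ
  set V : Ω → ℝ≥0∞ := fun ω => ∑' n, φ (X j n ω) with hV
  set Λ := ∑ i, ENNReal.ofReal (lam i) * ∫⁻ y, (1 - expNeg (u i y)) with hΛ
  have hZm : Measurable Z :=
    Measurable.tsum fun c => (hu c.1).comp ((hX c.1).measurable c.2)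
  have hVm : Measurable V := Measurable.tsum fun n => hφ.comp ((hX j).measurable n)
  -- The increase of the Laplace exponent when $\phi/m$ is added to $u_j$, as computed from
  -- `one_sub_expNeg_add`.
  set k : ℕ → ℝ≥0∞ := fun m => ENNReal.ofReal (lam j) *
    ∫⁻ y, expNeg (u j y) * (1 - expNeg (φ y / m)) with hk
  have hZV : ∀ m : ℕ, ∫⁻ ω, expNeg (Z ω + V ω / m) ∂μ = expNeg (Λ + k m) := by
    intro m
    set ψ : T → Plane → ℝ≥0∞ := fun i y => if i = j then φ y / m else 0 with hψ
    have hψm : ∀ i, Measurable (ψ i) := fun i => by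
      by_cases hi : i = j
      · simp only [hψ, hi, if_true]; fun_prop
      · simp only [hψ, hi, if_false]; fun_prop
    have h := laplace_family hX hind hlam (u := fun i y => u i y + ψ i y)
      (fun i => (hu i).add (hψm i))
    have h1 : ∀ ω, ∑' c : Σ i, ι i, (u c.1 (X c.1 c.2 ω) + ψ c.1 (X c.1 c.2 ω))
        = Z ω + V ω / m := by
      intro ω
      rw [ENNReal.tsum_add]
      congr 1
      rw [ENNReal.tsum_sigma', tsum_fintype, Finset.sum_eq_single j]
      · simp only [hψ, if_true, hV, div_eq_mul_inv, ENNReal.tsum_mul_right]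
      · intro i _ hi; simp [hψ, hi]
      · simp
    simp_rw [h1] at h
    rw [h]
    congr 1
    simp_rw [one_sub_expNeg_add]
    have h2 : ∀ i, ∫⁻ y, ((1 - expNeg (u i y)) + expNeg (u i y) * (1 - expNeg (ψ i y)))
        = (∫⁻ y, (1 - expNeg (u i y))) + ∫⁻ y, expNeg (u i y) * (1 - expNeg (ψ i y)) := by
      intro i
      have := hu i
      rw [lintegral_add_left (by fun_prop)]
    simp_rw [h2, mul_add, Finset.sum_add_distrib]
    congr 1
    rw [Finset.sum_eq_single j]
    · simp [hψ, hk]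
    · intro i _ hi; simp [hψ, hi]
    · simp
  have hdiff : ∀ m : ℕ, ∫⁻ ω, expNeg (Z ω) * (1 - expNeg (V ω / m)) ∂μ
      = expNeg Λ * (1 - expNeg (k m)) := by
    intro m
    have h0 := laplace_family hX hind hlam hu
    have h1 : ∀ ω, expNeg (Z ω) * (1 - expNeg (V ω / m))
        = expNeg (Z ω) - expNeg (Z ω + V ω / m) := fun ω => by
      rw [ENNReal.mul_sub (fun _ _ => expNeg_ne_top _), mul_one, expNeg_add]
    simp_rw [h1]
    rw [lintegral_sub (by fun_prop), hZV, ENNReal.mul_sub (fun _ _ => expNeg_ne_top _), mul_one,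
      expNeg_add, h0]
    · rw [hZV]; exact expNeg_ne_top _
    · exact .of_forall fun ω => expNeg_antitone le_self_add
  -- Both sides of `hdiff`, multiplied by $m$, have a limit: the left the wanted expectation, the
  -- right $K e^{-\Lambda}$. The latter uses $K<\infty$.
  have hlim := tendsto_lintegral_mul_one_sub_expNeg μ (W := fun ω => expNeg (Z ω)) (V := V)
    (by fun_prop) hVm
  simp_rw [hdiff] at hlim
  set K := ENNReal.ofReal (lam j) * ∫⁻ y, expNeg (u j y) * φ y with hK
  have hKfin : K ≠ ∞ := ENNReal.mul_ne_top ENNReal.ofReal_ne_top hfin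
  have huj := hu j
  have hkK : Tendsto (fun m : ℕ => (m : ℝ≥0∞) * k m) atTop (𝓝 K) := by
    have h := ENNReal.Tendsto.const_mul (a := ENNReal.ofReal (lam j))
      (tendsto_lintegral_mul_one_sub_expNeg volume
      (W := fun y => expNeg (u j y)) (V := φ) (by fun_prop) hφ) (Or.inr ENNReal.ofReal_ne_top)
    refine h.congr fun m => ?_
    rw [hk]; ring
  have hlim2 := ENNReal.Tendsto.mul_const (b := expNeg Λ)
    (tendsto_natCast_mul_one_sub_expNeg hKfin hkK) (Or.inr (expNeg_ne_top _))
  refine tendsto_nhds_unique hlim (hlim2.congr fun m => by ring)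

/-- The reduced Mecke formula: the product runs over the other points. -/
theorem reduced_mecke_family (hX : ∀ j, IsPoissonProcess (X j) (lam j) μ)
    (hind : iIndepFun (fun j ω (n : ι j) => X j n ω) μ) (hlam : ∀ j, 0 ≤ lam j)
    {u : T → Plane → ℝ≥0∞} (hu : ∀ j, Measurable (u j)) (j : T) (hfin : ∀ y, u j y ≠ ∞)
    {A : Set Plane} (hA : MeasurableSet A) (hA' : volume A ≠ ∞) :
    ∫⁻ ω, ∑' n, A.indicator (fun _ => (1 : ℝ≥0∞)) (X j n ω) *
        expNeg (∑' c : {c : Σ i, ι i // c ≠ ⟨j, n⟩}, u c.1.1 (X c.1.1 c.1.2 ω)) ∂μ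
      = ENNReal.ofReal (lam j) * volume A
        * expNeg (∑ i, ENNReal.ofReal (lam i) * ∫⁻ y, (1 - expNeg (u i y))) := by
  classical
  have huj := hu j
  have hne : ∀ y, expNeg (u j y) ≠ 0 := fun y => by
    simpa [expNeg] using hfin y
  have hcancel : ∀ y, expNeg (u j y) * (A.indicator (fun _ => (1 : ℝ≥0∞)) y * (expNeg (u j y))⁻¹)
      = A.indicator (fun _ => (1 : ℝ≥0∞)) y := fun y => by
    rw [mul_comm, mul_assoc, ENNReal.inv_mul_cancel (hne y) (expNeg_ne_top _), mul_one]
  have hint : ∫⁻ y, expNeg (u j y) * (A.indicator (fun _ => (1 : ℝ≥0∞)) y * (expNeg (u j y))⁻¹)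
      = volume A := by
    simp_rw [hcancel]
    exact lintegral_indicator_one hA
  -- The factor $e^{u_j}$ in $\phi$ cancels the contribution of the chosen point to the full
  -- exponential. Finiteness of $u_j$ keeps $e^{-u_j}$ nonzero.
  have h := mecke_family hX hind hlam hu j
    (φ := fun y => A.indicator (fun _ => (1 : ℝ≥0∞)) y * (expNeg (u j y))⁻¹)
    ((measurable_const.indicator hA).mul huj.expNeg.inv) (by rw [hint]; exact hA')
  rw [hint] at h
  rw [← h]
  refine lintegral_congr fun ω => ?_
  rw [← ENNReal.tsum_mul_left]
  refine tsum_congr fun n => ?_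
  have hsplit := ENNReal.tsum_eq_add_tsum_ite
    (f := fun c : Σ i, ι i => u c.1 (X c.1 c.2 ω)) (⟨j, n⟩ : Σ i, ι i)
  have hsub : ∑' c : {c : Σ i, ι i // c ≠ ⟨j, n⟩}, u c.1.1 (X c.1.1 c.1.2 ω)
      = ∑' c : Σ i, ι i, if c = ⟨j, n⟩ then 0 else u c.1 (X c.1 c.2 ω) := by
    have := tsum_subtype {c : Σ i, ι i | c ≠ ⟨j, n⟩} (fun c => u c.1 (X c.1 c.2 ω))
    refine this.trans (tsum_congr fun c => ?_)
    by_cases hc : c = ⟨j, n⟩ <;> simp [Set.indicator, hc]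
  rw [hsplit, expNeg_add, hsub, mul_right_comm, hcancel]
  congr!

end PoissonFamily

/-! ### Integrating out the exponential gains. -/

section ExponentialGains

lemma ae_pos_expMeasure {r : ℝ} : ∀ᵐ x ∂(expMeasure r), 0 < x := by
  have h : expMeasure r = volume.withDensity (exponentialPDF r) := rfl
  have hm : Measurable (exponentialPDF r) := (measurable_exponentialPDFReal r).ennreal_ofReal
  rw [h, ae_withDensity_iff hm]
  have h0 : ∀ᵐ x : ℝ, x ≠ 0 := Measure.ae_ne volume 0
  filter_upwards [h0] with x hx0 hx
  by_contra hneg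
  exact hx (exponentialPDF_of_neg (lt_of_le_of_ne (not_lt.1 hneg) hx0))

lemma lintegral_expNeg_expMeasure {a : ℝ} (ha : 0 ≤ a) :
    ∫⁻ x, expNeg (ENNReal.ofReal (a * x)) ∂(expMeasure 1)
      = expNeg (ENNReal.ofReal (Real.log (1 + a))) := by
  have h : expMeasure 1 = volume.withDensity (exponentialPDF 1) := rfl
  have hm : Measurable (exponentialPDF 1) := (measurable_exponentialPDFReal 1).ennreal_ofReal
  have hm' : Measurable (exponentialPDF (1 + a)) :=
    (measurable_exponentialPDFReal (1 + a)).ennreal_ofReal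
  rw [h, lintegral_withDensity_eq_lintegral_mul _ hm (by fun_prop)]
  have h1 : ∀ x, (exponentialPDF 1 * fun x => expNeg (ENNReal.ofReal (a * x))) x
      = ENNReal.ofReal (1 + a)⁻¹ * exponentialPDF (1 + a) x := by
    intro x
    rw [Pi.mul_apply]
    rcases lt_or_ge x 0 with hx | hx
    · simp [exponentialPDF_of_neg hx]
    · rw [exponentialPDF_of_nonneg hx, exponentialPDF_of_nonneg hx, expNeg_ofReal (by positivity),
        ← ENNReal.ofReal_mul (by positivity), ← ENNReal.ofReal_mul (by positivity)]
      congr 1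
      rw [one_mul, one_mul, ← Real.exp_add, ← mul_assoc, inv_mul_cancel₀ (by positivity), one_mul]
      congr 1; ring
  simp_rw [h1]
  rw [lintegral_const_mul _ hm', lintegral_exponentialPDF_eq_one (by positivity), mul_one,
    expNeg_ofReal (Real.log_nonneg (by linarith)), Real.exp_neg, Real.exp_log (by positivity)]

/-- The threshold is extended so that an infinite interference needs no separate treatment later. -/
lemma expMeasure_lt (t : ℝ≥0∞) : expMeasure 1 {x | t < ENNReal.ofReal x} = expNeg t := by
  have : IsProbabilityMeasure (expMeasure 1) := isProbabilityMeasure_expMeasure one_pos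
  induction t with
  | top => simp
  | coe t =>
    have h1 : {x : ℝ | (t : ℝ≥0∞) < ENNReal.ofReal x} = (Set.Iic (t : ℝ))ᶜ := by
      ext x
      simp only [Set.mem_ofPred_eq, Set.mem_compl_iff, Set.mem_Iic, not_le]
      rw [← ENNReal.ofReal_coe_nnreal, ENNReal.ofReal_lt_ofReal_iff_of_nonneg t.coe_nonneg]
    rw [h1, measure_compl measurableSet_Iic (measure_ne_top _ _), measure_univ, ← ofReal_cdf,
      cdf_expMeasure_eq one_pos, if_pos t.coe_nonneg, ← ENNReal.ofReal_coe_nnreal,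
      expNeg_ofReal t.coe_nonneg, ← ENNReal.ofReal_one, ← ENNReal.ofReal_sub]
    · rw [one_mul, sub_sub_cancel]
    · simp

variable {Ω κ : Type*} [MeasurableSpace Ω] [Countable κ] {μ : Measure Ω} [IsProbabilityMeasure μ]
  {g : κ → Ω → ℝ}

/-- Independence settles finite sets of gains. Dominated convergence with bound 1, along the net of
finite subsets of the countable index set, gives the rest even if the sum diverges. -/
lemma lintegral_expNeg_tsum_gain (hm : ∀ c, Measurable (g c))
    (hlaw : ∀ c, μ.map (g c) = expMeasure 1) (hind : iIndepFun g μ) {a : κ → ℝ}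
    (ha : ∀ c, 0 ≤ a c) :
    ∫⁻ ω, expNeg (∑' c, ENNReal.ofReal (a c * g c ω)) ∂μ
      = expNeg (∑' c, ENNReal.ofReal (Real.log (1 + a c))) := by
  have hfin : ∀ s : Finset κ, ∫⁻ ω, ∏ c ∈ s, expNeg (ENNReal.ofReal (a c * g c ω)) ∂μ
      = ∏ c ∈ s, expNeg (ENNReal.ofReal (Real.log (1 + a c))) := by
    intro s
    have hmeas : ∀ c, Measurable fun x : ℝ => expNeg (ENNReal.ofReal (a c * x)) := fun c => by
      fun_prop
    have h := lintegral_prod_eq_prod_lintegral_of_indepFun s _ (hind.comp _ hmeas)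
      fun c => (hmeas c).comp (hm c)
    simp only [Function.comp_apply] at h
    rw [h]
    refine Finset.prod_congr rfl fun c _ => ?_
    rw [← lintegral_expNeg_expMeasure (ha c), ← hlaw c, lintegral_map (hmeas c) (hm c)]
  have h1 : Tendsto (fun s : Finset κ => ∫⁻ ω, ∏ c ∈ s, expNeg (ENNReal.ofReal (a c * g c ω)) ∂μ)
      atTop (𝓝 (∫⁻ ω, expNeg (∑' c, ENNReal.ofReal (a c * g c ω)) ∂μ)) := by
    refine tendsto_lintegral_filter_of_dominated_convergence (fun _ => 1) ?_ ?_ (by simp) ?_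
    · exact .of_forall fun s => by fun_prop
    · refine .of_forall fun s => .of_forall fun ω => ?_
      exact Finset.prod_le_one' fun c _ => expNeg_le_one _
    · exact .of_forall fun ω => tendsto_expNeg_sum _
  refine tendsto_nhds_unique h1 ?_
  simp_rw [hfin]
  exact tendsto_expNeg_sum _

/-- The interference $Y$ involves only gains other than that of $b$, hence is independent of it, and
the exponential tail gives $P(Y<g_b)=E\,e^{-Y}$. -/
lemma measure_tsum_gain_lt (hm : ∀ c, Measurable (g c))
    (hlaw : ∀ c, μ.map (g c) = expMeasure 1) (hind : iIndepFun g μ) {a : κ → ℝ}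
    (ha : ∀ c, 0 ≤ a c) (b : κ) :
    μ {ω | ∑' c : {c // c ≠ b}, ENNReal.ofReal (a c * g c ω) < ENNReal.ofReal (g b ω)}
      = expNeg (∑' c : {c // c ≠ b}, ENNReal.ofReal (Real.log (1 + a c))) := by
  set Y : Ω → ℝ≥0∞ := fun ω => ∑' c : {c // c ≠ b}, ENNReal.ofReal (a c * g c ω) with hY
  have hYm : Measurable Y := Measurable.tsum fun c => by
    have := hm c
    fun_prop
  have hYb : IndepFun Y (g b) μ := by
    -- The σ-algebra generated by the gains off $b$ is independent of the one generated by the gain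
    -- of $b$.
    have h1 := indep_iSup_of_disjoint (m := fun c => MeasurableSpace.comap (g c) inferInstance)
      (fun c => (hm c).comap_le) hind.iIndep (S := {b}ᶜ) (T := {b}) disjoint_compl_left
    have h2 : IndepFun (fun ω (c : {c // c ≠ b}) => g c ω) (g b) μ := by
      refine indep_of_indep_of_le_left (indep_of_indep_of_le_right h1 ?_) ?_
      · exact le_iSup₂_of_le b rfl le_rfl
      · rw [MeasurableSpace.pi, MeasurableSpace.comap_iSup]
        refine iSup_le fun c => ?_
        rw [MeasurableSpace.comap_comp]
        exact le_iSup₂_of_le (f := fun i (_ : i ∈ ({b}ᶜ : Set κ)) =>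
          MeasurableSpace.comap (g i) inferInstance) c.1 c.2 le_rfl
    exact h2.comp (φ := fun x : {c // c ≠ b} → ℝ => ∑' c : {c // c ≠ b}, ENNReal.ofReal (a c * x c))
      (Measurable.tsum fun c => by fun_prop) measurable_id
  have hprod := (indepFun_iff_map_prod_eq_prod_map_map hYm.aemeasurable (hm b).aemeasurable).1 hYb
  have hS : MeasurableSet {p : ℝ≥0∞ × ℝ | p.1 < ENNReal.ofReal p.2} :=
    measurableSet_lt measurable_fst (ENNReal.measurable_ofReal.comp measurable_snd)
  have : IsProbabilityMeasure (expMeasure 1) := isProbabilityMeasure_expMeasure one_pos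
  calc μ {ω | Y ω < ENNReal.ofReal (g b ω)}
      = μ.map (fun ω => (Y ω, g b ω)) {p : ℝ≥0∞ × ℝ | p.1 < ENNReal.ofReal p.2} := by
        rw [Measure.map_apply (hYm.prodMk (hm b)) hS]; rfl
    _ = ∫⁻ t, expNeg t ∂(μ.map Y) := by
        rw [hprod, hlaw b, Measure.prod_apply hS]
        exact lintegral_congr fun t => expMeasure_lt t
    _ = ∫⁻ ω, expNeg (Y ω) ∂μ := lintegral_map measurable_expNeg hYm
    _ = _ := lintegral_expNeg_tsum_gain (g := fun c : {c // c ≠ b} => g c) (fun c => hm c)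
        (fun c => hlaw c) (hind.precomp Subtype.val_injective) fun c => ha c

/-- Integrating out exponential gains that are independent of the environment `X`. -/
theorem measure_tsum_gain_lt_of_indepFun {E : Type*} [MeasurableSpace E] {X : Ω → E}
    (hX : Measurable X) (hm : ∀ c, Measurable (g c))
    (hlaw : ∀ c, μ.map (g c) = expMeasure 1) (hind : iIndepFun g μ)
    (hXg : IndepFun X (fun ω c => g c ω) μ) {a : κ → E → ℝ} (ham : ∀ c, Measurable (a c))
    (ha : ∀ c x, 0 ≤ a c x) (b : κ) :
    μ {ω | ∑' c : {c // c ≠ b}, ENNReal.ofReal (a c (X ω) * g c ω) < ENNReal.ofReal (g b ω)}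
      = ∫⁻ ω, expNeg (∑' c : {c // c ≠ b}, ENNReal.ofReal (Real.log (1 + a c (X ω)))) ∂μ := by
  have hgm : Measurable fun ω c => g c ω := measurable_pi_lambda _ hm
  have hprod := (indepFun_iff_map_prod_eq_prod_map_map hX.aemeasurable hgm.aemeasurable).1 hXg
  set S : Set (E × (κ → ℝ)) := {p | ∑' c : {c // c ≠ b}, ENNReal.ofReal (a c p.1 * p.2 c)
    < ENNReal.ofReal (p.2 b)} with hSdef
  have hS : MeasurableSet S := by
    refine measurableSet_lt (Measurable.tsum fun c => ?_) (by fun_prop)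
    have := ham c
    fun_prop
  have : IsProbabilityMeasure (μ.map fun ω c => g c ω) :=
    Measure.isProbabilityMeasure_map hgm.aemeasurable
  calc μ {ω | ∑' c : {c // c ≠ b}, ENNReal.ofReal (a c (X ω) * g c ω) < ENNReal.ofReal (g b ω)}
      = μ.map (fun ω => (X ω, fun c => g c ω)) S := by
        rw [Measure.map_apply (hX.prodMk hgm) hS]; rfl
    _ = ∫⁻ x, expNeg (∑' c : {c // c ≠ b}, ENNReal.ofReal (Real.log (1 + a c x)))
          ∂(μ.map X) := by
        rw [hprod, Measure.prod_apply hS]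
        refine lintegral_congr fun x => ?_
        rw [Measure.map_apply hgm (measurable_prodMk_left hS),
          ← measure_tsum_gain_lt hm hlaw hind (fun c => ha c x) b]
        rfl
    _ = _ := by
        refine lintegral_map (Measurable.expNeg (Measurable.tsum fun c => ?_)) hX
        have := ham c
        fun_prop

end ExponentialGains

/-! ### Gaussian-type integrals over the plane and the constant $C(\alpha)$. -/

section PlanarIntegrals

/-- A nonzero Bochner integral already forces integrability, so $v>0$ replaces an integrability
proof. -/
lemma lintegral_ofReal_eq_of_integral_eq {E : Type*} [MeasurableSpace E] {ν : Measure E}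
    {f : E → ℝ} {v : ℝ} (hv : 0 < v) (hf : 0 ≤ᵐ[ν] f) (h : ∫ x, f x ∂ν = v) :
    ∫⁻ x, ENNReal.ofReal (f x) ∂ν = ENNReal.ofReal v := by
  rw [← h, ofReal_integral_eq_lintegral_ofReal (Integrable.of_integral_ne_zero (by
    rw [h]; exact hv.ne')) hf]

lemma lintegral_plane_exp_neg_mul_sq {k : ℝ} (hk : 0 < k) :
    ∫⁻ y : Plane, ENNReal.ofReal (Real.exp (-(k * ‖y‖ ^ 2))) = ENNReal.ofReal (Real.pi / k) := by
  refine lintegral_ofReal_eq_of_integral_eq (by positivity)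
    (.of_forall fun y => (Real.exp_pos _).le) ?_
  have h := GaussianFourier.integral_rexp_neg_mul_sq_norm (V := Plane) hk
  simp only [finrank_euclideanSpace, Fintype.card_fin] at h
  norm_num at h
  rw [← h]

lemma lintegral_plane_exp_neg_mul_rpow {s p : ℝ} (hs : 0 < s) (hp : 0 < p) :
    ∫⁻ y : Plane, ENNReal.ofReal (Real.exp (-s * ‖y‖ ^ p))
      = ENNReal.ofReal (Real.pi * (2 / p) * Real.Gamma (2 / p) * s ^ (-(2 / p))) := by
  have hG : 0 < Real.Gamma (2 / p) := Real.Gamma_pos_of_pos (by positivity)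
  refine lintegral_ofReal_eq_of_integral_eq (by positivity)
    (.of_forall fun y => (Real.exp_pos _).le) ?_
  rw [integral_fun_norm_addHaar volume (fun r => Real.exp (-s * r ^ p))]
  have h := integral_rpow_mul_exp_neg_mul_rpow (p := p) (q := 1) (b := s) hp (by norm_num) hs
  have hball : volume.real (Metric.ball (0 : Plane) 1) = Real.pi := by
    rw [measureReal_def, EuclideanSpace.volume_ball_fin_two]
    simp [Real.pi_pos.le]
  simp only [finrank_euclideanSpace, Fintype.card_fin, hball, smul_eq_mul, nsmul_eq_mul]
  norm_num at h ⊢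
  rw [h, neg_div]
  ring

lemma lintegral_Ioi_exp_neg_mul {c d : ℝ} (hc : 0 < c) (hd : 0 < d) :
    ∫⁻ s in Set.Ioi (0 : ℝ), ENNReal.ofReal (c * Real.exp (-(d * s))) = ENNReal.ofReal (c / d) := by
  refine lintegral_ofReal_eq_of_integral_eq (by positivity)
    (.of_forall fun y => by positivity) ?_
  have h := Real.integral_rpow_mul_exp_neg_mul_Ioi (a := 1) (r := d) one_pos hd
  simp only [sub_self, Real.rpow_zero, one_mul, Real.rpow_one, Real.Gamma_one, mul_one] at h
  rw [integral_const_mul, h]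
  ring

lemma lintegral_Ioi_exp_neg_mul_rpow {c q : ℝ} (hc : 0 < c) (hq : q < 1) :
    ∫⁻ s in Set.Ioi (0 : ℝ), ENNReal.ofReal (c * Real.exp (-(c * s)) * s ^ (-q))
      = ENNReal.ofReal (c ^ q * Real.Gamma (1 - q)) := by
  have hG : 0 < Real.Gamma (1 - q) := Real.Gamma_pos_of_pos (by linarith)
  refine lintegral_ofReal_eq_of_integral_eq (by positivity) ?_ ?_
  · refine (ae_restrict_iff' measurableSet_Ioi).2 (.of_forall fun s hs => ?_)
    have : (0 : ℝ) < s := hs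
    positivity
  have h := Real.integral_rpow_mul_exp_neg_mul_Ioi (a := 1 - q) (r := c) (by linarith) hc
  have h1 : ∀ s : ℝ, c * Real.exp (-(c * s)) * s ^ (-q)
      = c * (s ^ (1 - q - 1) * Real.exp (-(c * s))) := by
    intro s
    rw [show 1 - q - 1 = -q by ring]; ring
  simp_rw [h1]
  rw [integral_const_mul, h, ← mul_assoc, one_div, Real.inv_rpow hc.le, ← Real.rpow_neg hc.le]
  congr 1
  nth_rewrite 1 [← Real.rpow_one c]
  rw [← Real.rpow_add hc]
  congr 1; ring

lemma one_sub_expNeg_log_one_add {t : ℝ} (ht : 0 ≤ t) :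
    1 - expNeg (ENNReal.ofReal (Real.log (1 + t))) = ENNReal.ofReal (t / (1 + t)) := by
  rw [expNeg_ofReal (Real.log_nonneg (by linarith)), Real.exp_neg, Real.exp_log (by positivity),
    ← ENNReal.ofReal_one, ← ENNReal.ofReal_sub _ (by positivity)]
  congr 1
  field_simp
  ring

/-- The exponent of the Laplace functional of the interference from a Poisson field with
path loss exponent `p` and exponential gains. -/
theorem lintegral_plane_one_sub_expNeg_log {c p : ℝ} (hc : 0 < c) (hp : 2 < p) :
    ∫⁻ y : Plane, (1 - expNeg (ENNReal.ofReal (Real.log (1 + c * ‖y‖ ^ (-p)))))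
      = ENNReal.ofReal
        (Real.pi * ((2 * Real.pi / p) / Real.sin (2 * Real.pi / p)) * c ^ (2 / p)) := by
  have hp0 : 0 < p := by linarith
  have hq : 2 / p < 1 := (div_lt_one hp0).2 hp
  have hG : 0 < Real.Gamma (2 / p) := Real.Gamma_pos_of_pos (by positivity)
  -- The integrand is $c/(c+\|y\|^p)=\int_0^\infty ce^{-cs}e^{-s\|y\|^p}ds$. After Tonelli the inner
  -- planar integral is a multiple of $s^{-2/p}$, integrable at 0 because $p>2$.
  have h1 : ∀ᵐ y : Plane, 1 - expNeg (ENNReal.ofReal (Real.log (1 + c * ‖y‖ ^ (-p))))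
      = ∫⁻ s in Set.Ioi (0 : ℝ), ENNReal.ofReal (c * Real.exp (-(c * s))) *
          ENNReal.ofReal (Real.exp (-s * ‖y‖ ^ p)) := by
    filter_upwards [Measure.ae_ne volume (0 : Plane)] with y hy
    have hr : 0 < ‖y‖ := norm_pos_iff.2 hy
    have hrp : 0 < ‖y‖ ^ p := by positivity
    rw [one_sub_expNeg_log_one_add (by positivity)]
    have h2 : c * ‖y‖ ^ (-p) / (1 + c * ‖y‖ ^ (-p)) = c / (c + ‖y‖ ^ p) := by
      rw [Real.rpow_neg hr.le]
      field_simp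
      ring
    rw [h2, ← lintegral_Ioi_exp_neg_mul hc (by positivity)]
    refine lintegral_congr fun s => ?_
    rw [← ENNReal.ofReal_mul (by positivity), mul_assoc c, ← Real.exp_add]
    congr 3; ring
  rw [lintegral_congr_ae h1, lintegral_lintegral_swap]
  · have h3 : ∀ s ∈ Set.Ioi (0 : ℝ), ∫⁻ y : Plane, ENNReal.ofReal (c * Real.exp (-(c * s))) *
          ENNReal.ofReal (Real.exp (-s * ‖y‖ ^ p))
        = ENNReal.ofReal (Real.pi * (2 / p) * Real.Gamma (2 / p)) *
          ENNReal.ofReal (c * Real.exp (-(c * s)) * s ^ (-(2 / p))) := by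
      intro s hs
      rw [lintegral_const_mul _ (by fun_prop), lintegral_plane_exp_neg_mul_rpow hs hp0,
        ← ENNReal.ofReal_mul (by positivity), ← ENNReal.ofReal_mul (by positivity)]
      congr 1; ring
    rw [setLIntegral_congr_fun measurableSet_Ioi h3, lintegral_const_mul _ (by fun_prop),
      lintegral_Ioi_exp_neg_mul_rpow hc hq, ← ENNReal.ofReal_mul (by positivity)]
    congr 1
    -- Euler's reflection formula produces the sine in $C(\alpha)$.
    have h4 := Real.Gamma_mul_Gamma_one_sub (2 / p)
    rw [show Real.pi * (2 / p) = 2 * Real.pi / p by ring] at h4 ⊢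
    calc 2 * Real.pi / p * Real.Gamma (2 / p) * (c ^ (2 / p) * Real.Gamma (1 - 2 / p))
        = 2 * Real.pi / p * (Real.Gamma (2 / p) * Real.Gamma (1 - 2 / p)) * c ^ (2 / p) := by ring
      _ = _ := by rw [h4]; ring
  · fun_prop

end PlanarIntegrals

/-! ### Tiling the punctured plane by geometric annuli. -/

section Annuli

/-- The annulus of radii `q ^ k` and `q ^ (k + 1)`. -/
def annulus (q : ℝ) (k : ℤ) : Set Plane := {x | q ^ k ≤ ‖x‖ ∧ ‖x‖ < q ^ (k + 1)}

lemma measurableSet_annulus (q : ℝ) (k : ℤ) : MeasurableSet (annulus q k) :=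
  (measurableSet_le measurable_const measurable_norm).inter
    (measurableSet_lt measurable_norm measurable_const)

lemma volume_annulus_ne_top (q : ℝ) (k : ℤ) : volume (annulus q k) ≠ ∞ := by
  refine measure_ne_top_of_subset (s := Metric.ball (0 : Plane) (q ^ (k + 1))) (fun x hx => ?_)
    (measure_ball_lt_top (μ := volume)).ne
  rw [mem_ball_zero_iff]; exact hx.2

lemma tsum_indicator_annulus {q : ℝ} (hq : 1 < q) {x : Plane} (hx : x ≠ 0) :
    ∑' k, (annulus q k).indicator (fun _ => (1 : ℝ≥0∞)) x = 1 := by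
  obtain ⟨k, hk1, hk2⟩ := exists_mem_Ico_zpow (norm_pos_iff.2 hx) hq
  have hk : x ∈ annulus q k := ⟨hk1, hk2⟩
  rw [tsum_eq_single k, Set.indicator_of_mem hk]
  intro l hl
  refine Set.indicator_of_notMem (fun h => hl ?_) _
  have h1 : k < l + 1 := (zpow_lt_zpow_iff_right₀ hq).1 (hk1.trans_lt h.2)
  have h2 : l < k + 1 := (zpow_lt_zpow_iff_right₀ hq).1 (h.1.trans_lt hk2)
  omega

lemma tsum_setLIntegral_annulus {q : ℝ} (hq : 1 < q) {f : Plane → ℝ≥0∞} (hf : Measurable f) :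
    ∑' k, ∫⁻ x in annulus q k, f x = ∫⁻ x, f x := by
  simp_rw [← lintegral_indicator (measurableSet_annulus q _)]
  rw [← lintegral_tsum fun k => (hf.indicator (measurableSet_annulus q k)).aemeasurable]
  refine lintegral_congr_ae ?_
  filter_upwards [Measure.ae_ne volume (0 : Plane)] with x hx
  have h : ∀ k, (annulus q k).indicator f x
      = (annulus q k).indicator (fun _ => (1 : ℝ≥0∞)) x * f x := fun k => by
    by_cases hk : x ∈ annulus q k <;> simp [hk]
  simp_rw [h]
  rw [ENNReal.tsum_mul_right, tsum_indicator_annulus hq hx, one_mul]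

end Annuli

/-- The number of points in the null set $\{0\}$ is Poisson with mean 0. -/
lemma IsPoissonProcess.ae_ne_zero {Ω ι : Type*} [MeasurableSpace Ω] {μ : Measure Ω}
    [IsProbabilityMeasure μ] {X : ι → Ω → Plane} {lam : ℝ}
    (hX : IsPoissonProcess X lam μ) (n : ι) : ∀ᵐ ω ∂μ, X n ω ≠ 0 := by
  have h := hX.poisson {0} (measurableSet_singleton _) (by simp) 0
  have h1 : μ {ω | X n ω ≠ 0} = 1 := by
    refine le_antisymm prob_le_one ?_
    have h2 : μ {ω | pointCount X {0} ω = ((0 : ℕ) : ℕ∞)} = 1 := by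
      rw [h]; simp [measureReal_def]
    rw [← h2]
    refine measure_mono fun ω hω h0 => ?_
    have h3 : pointCount X {0} ω = 0 := by simpa using hω
    rw [pointCount, Set.encard_eq_zero] at h3
    have : n ∈ {n | X n ω ∈ ({0} : Set Plane)} := h0
    rw [h3] at this
    exact this
  have hm : MeasurableSet {ω | X n ω ≠ 0} :=
    (hX.measurable n) (measurableSet_singleton (0 : Plane)).compl
  exact (prob_compl_eq_zero_iff hm).2 h1

/-! ### The expected number of covered points: from fixed to random serving distance. -/

section Scaling

/-- The conditional probability, given the locations, that the gain of the point `b` exceeds the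
interference scaled to a serving distance `r`. -/
noncomputable def coverage {Ω T : Type*} {ι : T → Type*} (X : (j : T) → ι j → Ω → Plane)
    (p : ℝ) (a : T → ℝ) (b : Σ j, ι j) (r : ℝ) (ω : Ω) : ℝ≥0∞ :=
  expNeg (∑' c : {c : Σ j, ι j // c ≠ b},
    ENNReal.ofReal (Real.log (1 + a c.1.1 * r ^ p * ‖X c.1.1 c.1.2 ω‖ ^ (-p))))

/-- A longer serving distance only makes the interferers relatively stronger. This monotonicity
allows the distance to be replaced by the radii of an annulus. -/
lemma coverage_antitone {Ω T : Type*} {ι : T → Type*}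
    {X : (j : T) → ι j → Ω → Plane} {p : ℝ} (hp : 0 < p) {a : T → ℝ} (ha : ∀ i, 0 < a i)
    (b : Σ j, ι j)
    (ω : Ω) {r s : ℝ} (hr : 0 ≤ r) (hrs : r ≤ s) :
    coverage X p a b s ω ≤ coverage X p a b r ω := by
  refine expNeg_antitone (ENNReal.tsum_le_tsum fun c => ENNReal.ofReal_le_ofReal ?_)
  have := ha c.1.1
  have h1 : r ^ p ≤ s ^ p := Real.rpow_le_rpow hr hrs hp.le
  refine Real.log_le_log (by positivity) ?_
  gcongr

variable {Ω T : Type*} [MeasurableSpace Ω] [Fintype T] {ι : T → Type*} [∀ j, Countable (ι j)]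
  {μ : Measure Ω} {X : (j : T) → ι j → Ω → Plane} {lam : T → ℝ}

lemma measurable_coverage (hX : ∀ j, IsPoissonProcess (X j) (lam j) μ) (p : ℝ) (a : T → ℝ)
    (b : Σ j, ι j) {r : Ω → ℝ} (hr : Measurable r) :
    Measurable fun ω => coverage X p a b (r ω) ω := by
  refine Measurable.expNeg (Measurable.tsum fun c => ?_)
  have := (hX c.1.1).measurable c.1.2
  fun_prop

variable [IsProbabilityMeasure μ]

/-- With the serving distance frozen at $r$ the exponent is a sum of a fixed function over the other
points, so the reduced Mecke formula applies. The square of $r$ comes from $(r^p)^{2/p}$. -/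
lemma lintegral_tsum_indicator_coverage (hX : ∀ j, IsPoissonProcess (X j) (lam j) μ)
    (hind : iIndepFun (fun j ω (n : ι j) => X j n ω) μ) (hlam : ∀ j, 0 ≤ lam j)
    {p : ℝ} (hp : 2 < p) {a : T → ℝ} (ha : ∀ i, 0 < a i) (j : T)
    {A : Set Plane} (hA : MeasurableSet A) (hA' : volume A ≠ ∞) {r : ℝ} (hr : 0 < r) :
    ∫⁻ ω, ∑' n, A.indicator (fun _ => (1 : ℝ≥0∞)) (X j n ω) * coverage X p a ⟨j, n⟩ r ω ∂μ
      = ENNReal.ofReal (lam j) * volume A * ENNReal.ofReal (Real.exp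
        (-(Real.pi * ((2 * Real.pi / p) / Real.sin (2 * Real.pi / p)) *
          ∑ i, lam i * a i ^ (2 / p)) * r ^ 2)) := by
  have hC : 0 < (2 * Real.pi / p) / Real.sin (2 * Real.pi / p) := by
    have h1 : 0 < 2 * Real.pi / p := by positivity
    refine div_pos h1 (Real.sin_pos_of_pos_of_lt_pi h1 ?_)
    rw [div_lt_iff₀ (by linarith)]
    nlinarith [Real.pi_pos]
  set C := (2 * Real.pi / p) / Real.sin (2 * Real.pi / p) with hCdef
  have h := reduced_mecke_family hX hind hlam
    (u := fun i y => ENNReal.ofReal (Real.log (1 + a i * r ^ p * ‖y‖ ^ (-p))))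
    (fun i => by fun_prop) j (fun y => ENNReal.ofReal_ne_top) hA hA'
  refine h.trans ?_
  congr 1
  have h1 : ∀ i, ENNReal.ofReal (lam i) * ∫⁻ y : Plane, (1 - expNeg (ENNReal.ofReal
      (Real.log (1 + a i * r ^ p * ‖y‖ ^ (-p)))))
      = ENNReal.ofReal (Real.pi * C * (lam i * a i ^ (2 / p)) * r ^ 2) := by
    intro i
    have hai := ha i
    rw [lintegral_plane_one_sub_expNeg_log (by positivity) hp, ← ENNReal.ofReal_mul (hlam i),
      Real.mul_rpow hai.le (by positivity), ← Real.rpow_mul hr.le,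
      show p * (2 / p) = (2 : ℝ) by field_simp, Real.rpow_two]
    congr 1; ring
  simp_rw [h1]
  have hnn : ∀ i, 0 ≤ Real.pi * C * (lam i * a i ^ (2 / p)) * r ^ 2 := fun i => by
    have := ha i; have := hlam i
    positivity
  rw [← ENNReal.ofReal_sum_of_nonneg fun i _ => hnn i,
    expNeg_ofReal (Finset.sum_nonneg fun i _ => hnn i), ← Finset.sum_mul, ← Finset.mul_sum, neg_mul]

/-- The expected number of covered points of tier `j`, in a network without noise. -/
theorem lintegral_tsum_coverage (hX : ∀ j, IsPoissonProcess (X j) (lam j) μ)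
    (hind : iIndepFun (fun j ω (n : ι j) => X j n ω) μ) (hlam : ∀ j, 0 ≤ lam j)
    {p : ℝ} (hp : 2 < p) {a : T → ℝ} (ha : ∀ i, 0 < a i) (j : T)
    {k : ℝ} (hk : 0 < k)
    (hkdef : k = Real.pi * ((2 * Real.pi / p) / Real.sin (2 * Real.pi / p)) *
      ∑ i, lam i * a i ^ (2 / p)) :
    ∫⁻ ω, ∑' n, coverage X p a ⟨j, n⟩ ‖X j n ω‖ ω ∂μ
      = ENNReal.ofReal (lam j) * ENNReal.ofReal (Real.pi / k) := by
  have hp0 : 0 < p := by linarith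
  have hsplit : ∀ q : ℝ, 1 < q → ∫⁻ ω, ∑' n, coverage X p a ⟨j, n⟩ ‖X j n ω‖ ω ∂μ
      = ∑' l, ∫⁻ ω, ∑' n, (annulus q l).indicator (fun _ => (1 : ℝ≥0∞)) (X j n ω) *
          coverage X p a ⟨j, n⟩ ‖X j n ω‖ ω ∂μ := by
    intro q hq
    rw [← lintegral_tsum]
    · refine lintegral_congr_ae ?_
      have hne : ∀ᵐ ω ∂μ, ∀ n, X j n ω ≠ 0 := ae_all_iff.2 fun n => (hX j).ae_ne_zero n
      filter_upwards [hne] with ω hω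
      rw [ENNReal.tsum_comm]
      refine tsum_congr fun n => ?_
      rw [ENNReal.tsum_mul_right, tsum_indicator_annulus hq (hω n), one_mul]
    · intro l
      refine (Measurable.tsum fun n => ?_).aemeasurable
      have hn := (hX j).measurable n
      exact ((measurable_const.indicator (measurableSet_annulus q l)).comp hn).mul
        (measurable_coverage hX p a _ hn.norm)
  have hfix : ∀ q : ℝ, 1 < q → ∀ (w : ℤ → ℝ), (∀ l, 0 < w l) → ∀ l,
      ∫⁻ ω, ∑' n, (annulus q l).indicator (fun _ => (1 : ℝ≥0∞)) (X j n ω) *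
          coverage X p a ⟨j, n⟩ (w l) ω ∂μ
        = ENNReal.ofReal (lam j) *
          ∫⁻ x in annulus q l, ENNReal.ofReal (Real.exp (-(k * (w l) ^ 2))) := by
    intro q hq w hw l
    rw [lintegral_tsum_indicator_coverage hX hind hlam hp ha j (measurableSet_annulus q l)
      (volume_annulus_ne_top q l) (hw l), setLIntegral_const, ← hkdef, neg_mul]
    ring
  -- Freeze the distance at the inner radius $q^l$. On the annulus $\|x\|<q^l q$, so
  -- $e^{-kq^{2l}}\le e^{-(k/q^2)\|x\|^2}$, and the annuli reassemble to a Gaussian integral.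
  have hupper : ∀ q : ℝ, 1 < q → ∫⁻ ω, ∑' n, coverage X p a ⟨j, n⟩ ‖X j n ω‖ ω ∂μ
      ≤ ENNReal.ofReal (lam j) * ENNReal.ofReal (Real.pi / (k / q ^ 2)) := by
    intro q hq
    have hq0 : 0 < q := by linarith
    rw [hsplit q hq, ← lintegral_plane_exp_neg_mul_sq (by positivity),
      ← tsum_setLIntegral_annulus hq (by fun_prop), ← ENNReal.tsum_mul_left]
    refine ENNReal.tsum_le_tsum fun l => ?_
    calc _ ≤ ∫⁻ ω, ∑' n, (annulus q l).indicator (fun _ => (1 : ℝ≥0∞)) (X j n ω) *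
          coverage X p a ⟨j, n⟩ (q ^ l) ω ∂μ := by
          refine lintegral_mono fun ω => ENNReal.tsum_le_tsum fun n => ?_
          by_cases hx : X j n ω ∈ annulus q l
          · simp only [Set.indicator_of_mem hx, one_mul]
            exact coverage_antitone hp0 ha _ ω (by positivity) hx.1
          · simp [hx]
      _ ≤ _ := by
          rw [hfix q hq (fun l => q ^ l) (fun l => by positivity)]
          refine mul_le_mul_right (setLIntegral_mono (by fun_prop) fun x hx => ?_) _
          refine ENNReal.ofReal_le_ofReal (Real.exp_le_exp.2 (neg_le_neg ?_))
          rw [div_mul_eq_mul_div, div_le_iff₀ (by positivity), mul_assoc, ← mul_pow]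
          have h2 : ‖x‖ ≤ q ^ l * q := by rw [← zpow_add_one₀ hq0.ne']; exact hx.2.le
          gcongr
  -- The same with the outer radius $q^{l+1}\le q\|x\|$. The two bounds meet as $q\downarrow1$.
  have hlower : ∀ q : ℝ, 1 < q → ENNReal.ofReal (lam j) * ENNReal.ofReal (Real.pi / (k * q ^ 2))
      ≤ ∫⁻ ω, ∑' n, coverage X p a ⟨j, n⟩ ‖X j n ω‖ ω ∂μ := by
    intro q hq
    have hq0 : 0 < q := by linarith
    rw [hsplit q hq, ← lintegral_plane_exp_neg_mul_sq (by positivity),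
      ← tsum_setLIntegral_annulus hq (by fun_prop), ← ENNReal.tsum_mul_left]
    refine ENNReal.tsum_le_tsum fun l => ?_
    calc _ ≤ ∫⁻ ω, ∑' n, (annulus q l).indicator (fun _ => (1 : ℝ≥0∞)) (X j n ω) *
          coverage X p a ⟨j, n⟩ (q ^ (l + 1)) ω ∂μ := by
          rw [hfix q hq (fun l => q ^ (l + 1)) (fun l => by positivity)]
          refine mul_le_mul_right (setLIntegral_mono (by fun_prop) fun x hx => ?_) _
          refine ENNReal.ofReal_le_ofReal (Real.exp_le_exp.2 (neg_le_neg ?_))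
          have h2 : q ^ (l + 1) ≤ q * ‖x‖ := by
            rw [zpow_add_one₀ hq0.ne', mul_comm]; gcongr; exact hx.1
          rw [mul_assoc, ← mul_pow]
          gcongr
      _ ≤ _ := by
          refine lintegral_mono fun ω => ENNReal.tsum_le_tsum fun n => ?_
          by_cases hx : X j n ω ∈ annulus q l
          · simp only [Set.indicator_of_mem hx, one_mul]
            exact coverage_antitone hp0 ha _ ω (norm_nonneg _) hx.2.le
          · simp [hx]
  have hgt : ∀ᶠ q : ℝ in 𝓝[>] 1, 1 < q := eventually_mem_nhdsWithin
  have hlim : ∀ f : ℝ → ℝ, ContinuousAt f 1 → f 1 = Real.pi / k →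
      Tendsto (fun q => ENNReal.ofReal (lam j) * ENNReal.ofReal (f q)) (𝓝[>] 1)
        (𝓝 (ENNReal.ofReal (lam j) * ENNReal.ofReal (Real.pi / k))) := by
    intro f hf h1
    refine ENNReal.Tendsto.const_mul (ENNReal.tendsto_ofReal ?_) (Or.inr ENNReal.ofReal_ne_top)
    rw [← h1]
    exact hf.tendsto.mono_left nhdsWithin_le_nhds
  refine le_antisymm (ge_of_tendsto (hlim (fun q => Real.pi / (k / q ^ 2)) ?_ (by simp))
    (hgt.mono hupper)) (le_of_tendsto (hlim (fun q => Real.pi / (k * q ^ 2)) ?_ (by simp))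
    (hgt.mono hlower))
  · refine ContinuousAt.div continuousAt_const (ContinuousAt.div continuousAt_const
      (by fun_prop) (by norm_num)) (by simp [hk.ne'])
  · refine ContinuousAt.div continuousAt_const (by fun_prop) (by simp [hk.ne'])

end Scaling

/-! ### Finiteness of the set of tiers, signs of the coefficients, thresholds. -/

instance : DecidableEq Tier := fun i j => by
  cases i <;> cases j <;> first | exact isTrue rfl | exact isFalse nofun

instance : Fintype Tier := ⟨{.Fc, .Fn, .R}, fun j => by cases j <;> decide⟩

lemma Tier.sum_eq {M : Type*} [AddCommMonoid M] (f : Tier → M) :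
    ∑ j, f j = f .Fc + (f .Fn + f .R) := by
  change ∑ j ∈ ({.Fc, .Fn, .R} : Finset Tier), f j = _
  rw [Finset.sum_insert (by decide), Finset.sum_pair (by decide)]

/-- This is $K\,\mathrm B(K,b)<1$ for $K=n+1$, cleared of denominators; it makes $\zeta$ positive.
In the induction step the left side gains the factor $n+2$, the right side the larger factor
$n+1+b$. -/
lemma Gamma_natCast_mul_Gamma_lt {b : ℝ} (hb : 1 < b) (n : ℕ) :
    Real.Gamma ((n : ℝ) + 1 + 1) * Real.Gamma b < Real.Gamma ((n : ℝ) + 1 + b) := by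
  induction n with
  | zero =>
    have hG : 0 < Real.Gamma b := Real.Gamma_pos_of_pos (by linarith)
    have h1 : Real.Gamma (1 + 1) = 1 := by
      rw [Real.Gamma_add_one one_ne_zero, Real.Gamma_one, mul_one]
    simp only [Nat.cast_zero, zero_add, h1, one_mul]
    rw [add_comm 1 b, Real.Gamma_add_one (by linarith)]
    nlinarith
  | succ n ih =>
    have hn : (0 : ℝ) ≤ n := n.cast_nonneg
    push_cast
    rw [Real.Gamma_add_one (s := (n : ℝ) + 1 + 1) (by positivity),
      show (n : ℝ) + 1 + 1 + b = ((n : ℝ) + 1 + b) + 1 by ring,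
      Real.Gamma_add_one (s := (n : ℝ) + 1 + b) (by positivity), mul_assoc]
    have hG : 0 < Real.Gamma ((n : ℝ) + 1 + b) := Real.Gamma_pos_of_pos (by positivity)
    calc ((n : ℝ) + 1 + 1) * (Real.Gamma ((n : ℝ) + 1 + 1) * Real.Gamma b)
        < ((n : ℝ) + 1 + 1) * Real.Gamma ((n : ℝ) + 1 + b) := by gcongr
      _ ≤ _ := by gcongr

lemma natCast_mul_beta_lt_one {b : ℝ} (hb : 1 < b) {K : ℕ} (hK : K ≠ 0) :
    (K : ℝ) * ProbabilityTheory.beta K b < 1 := by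
  obtain ⟨n, rfl⟩ := Nat.exists_eq_succ_of_ne_zero hK
  have hG : 0 < Real.Gamma ((n : ℝ) + 1 + b) := Real.Gamma_pos_of_pos (by positivity)
  push_cast
  rw [ProbabilityTheory.beta, ← mul_div_assoc, div_lt_one hG, ← mul_assoc,
    ← Real.Gamma_add_one (by positivity)]
  exact Gamma_natCast_mul_Gamma_lt hb n

/-- The unit disc contains two points with positive probability, which one index cannot provide.
Hence every station has an interferer in a tier of positive density. -/
lemma IsPoissonProcess.nontrivial {Ω ι : Type*} [MeasurableSpace Ω] {μ : Measure Ω}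
    {X : ι → Ω → Plane} {lam : ℝ} (hX : IsPoissonProcess X lam μ) (hlam : 0 < lam) :
    Nontrivial ι := by
  by_contra hnt
  rw [not_nontrivial_iff_subsingleton] at hnt
  have hvol : 0 < volume.real (Metric.ball (0 : Plane) 1) :=
    ENNReal.toReal_pos (Metric.measure_ball_pos volume _ one_pos).ne' measure_ball_lt_top.ne
  have h2 := hX.poisson (Metric.ball 0 1) measurableSet_ball measure_ball_lt_top.ne 2
  have h3 : {ω | pointCount X (Metric.ball 0 1) ω = ((2 : ℕ) : ℕ∞)} = ∅ := by
    refine Set.eq_empty_of_forall_notMem fun ω hω => ?_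
    have h4 : pointCount X (Metric.ball 0 1) ω ≤ 1 :=
      Set.encard_le_one_iff_subsingleton.2 Set.subsingleton_of_subsingleton
    have h5 : pointCount X (Metric.ball 0 1) ω = ((2 : ℕ) : ℕ∞) := hω
    rw [h5] at h4
    exact absurd h4 (by decide)
  rw [h3, measure_empty, eq_comm, ENNReal.ofReal_eq_zero] at h2
  exact absurd h2 (not_le.2 (by positivity))

namespace FRAN

variable {net : FRAN}

lemma ζ_pos (hNB : 2 ≤ net.NB) : 0 < net.ζ := by
  have hN : (2 : ℝ) ≤ net.NB := by exact_mod_cast hNB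
  have hb : 1 < (net.NB : ℝ) / ((net.NB : ℝ) - 1) := by
    rw [one_lt_div (by linarith)]; linarith
  have h := natCast_mul_beta_lt_one hb (K := 2 ^ net.B) (by positivity)
  push_cast at h
  rw [ζ]
  linarith

lemma υ_pos : 0 < net.υ := by unfold υ; positivity

lemma υ_le_one (hNB : 2 ≤ net.NB) : net.υ ≤ 1 := by
  have hN : (2 : ℝ) ≤ net.NB := by exact_mod_cast hNB
  refine Real.rpow_le_one_of_one_le_of_nonpos one_le_two ?_
  have : (0 : ℝ) ≤ net.B := net.B.cast_nonneg
  have h1 : 0 < (net.NB : ℝ) - 1 := by linarith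
  rw [neg_nonpos]
  positivity

lemma servingCoeff_pos (hNB : 2 ≤ net.NB) (j : Tier) : 0 < net.servingCoeff j := by
  cases j
  · exact one_pos
  · exact one_pos
  · exact ζ_pos hNB

lemma interferenceCoeff_pos (j i : Tier) : 0 < net.interferenceCoeff j i := by
  cases j <;> cases i <;> first | exact one_pos | exact υ_pos

lemma pow_pos (hpowF : 0 < net.powF) (hpowR : 0 < net.powR) (j : Tier) : 0 < net.pow j := by
  cases j <;> assumption

lemma lam_nonneg (hlamF : 0 < net.lamF) (hlamR : 0 < net.lamR) (hpHit0 : 0 ≤ net.pHit)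
    (hpHit1 : net.pHit ≤ 1) (j : Tier) : 0 ≤ net.lam j := by
  cases j
  · exact mul_nonneg hpHit0 hlamF.le
  · exact mul_nonneg (by linarith) hlamF.le
  · exact hlamR.le

section Thresholds

variable {η : Tier → ℝ}

lemma threshold_pos (hNB : 2 ≤ net.NB) (hηFc : 1 < η .Fc) (hηFn : 1 < η .Fn)
    (hηR : net.ζ / net.υ < η .R) (j : Tier) : 0 < η j := by
  cases j
  · linarith
  · linarith
  · exact (div_pos (ζ_pos hNB) υ_pos).trans hηR

/-- The quantitative core of uniqueness. For an RRH facing RRHs it is $\eta_R\upsilon>\zeta$; facing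
F-APs it follows from this and $\upsilon\le1$; for F-APs it is $\eta>1$. -/
lemma servingCoeff_lt (hNB : 2 ≤ net.NB) (hηFc : 1 < η .Fc) (hηFn : 1 < η .Fn)
    (hηR : net.ζ / net.υ < η .R) (j i : Tier) :
    net.servingCoeff j < η j * net.interferenceCoeff j i := by
  have h1 : net.ζ < η .R * net.υ := (div_lt_iff₀ υ_pos).1 hηR
  have h2 : η .R * net.υ ≤ η .R * 1 :=
    mul_le_mul_of_nonneg_left (υ_le_one hNB) (threshold_pos hNB hηFc hηFn hηR .R).le
  cases j <;> cases i <;> simp only [servingCoeff, interferenceCoeff] <;> linarith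

end Thresholds

/-- The power of an interferer of tier `i` relative to a serving base station of tier `j`, scaled
by the threshold of tier `j`. -/
noncomputable def relativePower (net : FRAN) (η : Tier → ℝ) (j i : Tier) : ℝ :=
  η j * (net.interferenceCoeff j i * net.pow i) / (net.servingCoeff j * net.pow j)

/-! ### Delays, SINR thresholds and uniqueness of the qualifying station. -/

section Success

variable {Ω : Type*} {ι : Tier → Type*} {X : (j : Tier) → ι j → Ω → Plane}
  {h : (j : Tier) → ι j → Ω → ℝ} {rate : ℝ → ℝ} {η : Tier → ℝ}

/-- If the queue is stable, the delay bound rearranges to a bound on the rate. If not, the delay is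
`⊤` and the rate is at most the traffic, hence below the rate at the threshold. -/
lemma delay_lt_iff (hL : 0 < net.L) (hβ : ∀ j, net.linkLatency j < net.β j)
    (hrate : StrictMonoOn rate (Set.Ici 0))
    (hη : ∀ j, rate (η j) = net.traffic j + net.L / (net.β j - net.linkLatency j))
    (hη0 : ∀ j, 0 < η j) (b : Σ j, ι j) (ω : Ω) :
    net.delay rate X h b ω < (net.β b.1 : EReal) ↔ η b.1 < (net.sinr X h b ω).toReal := by
  set γ := (net.sinr X h b ω).toReal with hγ
  have hγ0 : 0 ≤ γ := ENNReal.toReal_nonneg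
  rw [← hrate.lt_iff_lt (Set.mem_Ici.2 (hη0 b.1).le) (Set.mem_Ici.2 hγ0), hη, delay, ← hγ]
  have hd : 0 < net.β b.1 - net.linkLatency b.1 := by linarith [hβ b.1]
  have hq : 0 < net.L / (net.β b.1 - net.linkLatency b.1) := by positivity
  split_ifs with ht
  · rw [EReal.coe_lt_coe_iff, ← lt_sub_iff_add_lt, div_lt_comm₀ (by linarith) hd,
      lt_sub_iff_add_lt, add_comm]
  · simp only [not_top_lt, false_iff, not_lt]
    linarith

/-- A base station above its threshold is received with more power than any other one. -/
lemma received_lt_received (hs : ∀ j i, net.servingCoeff j < η j * net.interferenceCoeff j i)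
    (hs0 : ∀ j, 0 < net.servingCoeff j) (hη0 : ∀ j, 0 < η j)
    {b c : Σ j, ι j} (hcb : c ≠ b) {ω : Ω} (hb : η b.1 < (net.sinr X h b ω).toReal) :
    0 < net.received X h b ω ∧ net.received X h c ω < net.received X h b ω := by
  -- `toReal` sends an infinite SINR to 0, which is below the threshold.
  have hne : net.sinr X h b ω ≠ ∞ := fun htop => by
    rw [htop, ENNReal.toReal_top] at hb; exact (hη0 b.1).not_gt hb
  have hlt : ENNReal.ofReal (η b.1) < net.sinr X h b ω :=
    (ENNReal.ofReal_lt_iff_lt_toReal (hη0 b.1).le hne).2 hb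
  rw [sinr] at hlt
  set D := net.interference X h b ω + ENNReal.ofReal net.noise
  have hmul : ENNReal.ofReal (η b.1) * D
      < ENNReal.ofReal (net.servingCoeff b.1 * net.received X h b ω) := by
    exact ENNReal.mul_lt_of_lt_div hlt
  have hpos : 0 < net.received X h b ω := by
    have := ENNReal.ofReal_pos.1 (zero_le.trans_lt hmul)
    exact pos_of_mul_pos_right this (hs0 b.1).le
  refine ⟨hpos, lt_of_not_ge fun hle => ?_⟩
  have hterm : ENNReal.ofReal (net.interferenceCoeff b.1 c.1 * net.received X h c ω) ≤ D :=
    le_trans (ENNReal.le_tsum (f := fun c : {c : Σ j, ι j // c ≠ b} =>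
      ENNReal.ofReal (net.interferenceCoeff b.1 c.1.1 * net.received X h c.1 ω)) ⟨c, hcb⟩)
      le_self_add
  -- One interferer alone is already too strong: $\eta\,\kappa\,g_c<s\,g_b$, with $s$ the serving
  -- and $\kappa$ the interference coefficient, contradicts $s<\eta\kappa$ and $0<g_b\le g_c$.
  have h1 := (mul_le_mul_right hterm (ENNReal.ofReal (η b.1))).trans_lt hmul
  rw [← ENNReal.ofReal_mul (hη0 b.1).le, ENNReal.ofReal_lt_ofReal_iff (mul_pos (hs0 b.1) hpos),
    ← mul_assoc] at h1
  have h2 := hs b.1 c.1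
  have h3 := mul_le_mul_of_nonneg_left hle ((hs0 b.1).trans h2).le
  nlinarith

lemma eq_of_threshold_lt (hs : ∀ j i, net.servingCoeff j < η j * net.interferenceCoeff j i)
    (hs0 : ∀ j, 0 < net.servingCoeff j) (hη0 : ∀ j, 0 < η j)
    {b c : Σ j, ι j} {ω : Ω} (hb : η b.1 < (net.sinr X h b ω).toReal)
    (hc : η c.1 < (net.sinr X h c ω).toReal) : b = c := by
  by_contra hbc
  exact lt_asymm (received_lt_received hs hs0 hη0 (Ne.symm hbc) hb).2
    (received_lt_received hs hs0 hη0 hbc hc).2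

lemma successEvent_eq
    (hd : ∀ (b : Σ j, ι j) ω, net.delay rate X h b ω < (net.β b.1 : EReal) ↔
      η b.1 < (net.sinr X h b ω).toReal) (j : Tier) :
    net.successEvent rate X h j = ⋃ n, {ω | η j < (net.sinr X h ⟨j, n⟩ ω).toReal} := by
  unfold successEvent
  congr! 3 with n
  ext ω
  exact hd ⟨j, n⟩ ω

/-- A qualifying station has no competitor but itself, so it has the lowest delay automatically. -/
lemma assocEvent_eq
    (hd : ∀ (b : Σ j, ι j) ω, net.delay rate X h b ω < (net.β b.1 : EReal) ↔
      η b.1 < (net.sinr X h b ω).toReal)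
    (huniq : ∀ (b c : Σ j, ι j) ω, η b.1 < (net.sinr X h b ω).toReal →
      η c.1 < (net.sinr X h c ω).toReal → b = c) (j : Tier) :
    net.assocEvent rate X h j = net.successEvent rate X h j := by
  ext ω
  simp only [assocEvent, successEvent, Set.mem_ofPred_eq, Set.mem_iUnion]
  refine ⟨fun ⟨n, hn, _⟩ => ⟨n, hn⟩, fun ⟨n, hn⟩ => ⟨n, hn, fun c hc => ?_⟩⟩
  rw [huniq ⟨j, n⟩ c ω ((hd _ ω).1 hn) ((hd c ω).1 hc)]

/-- The SINR exceeds a threshold iff the gain of the serving base station exceeds the normalized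
interference. -/
lemma threshold_lt_iff (hnoise : net.noise = 0) (hpow : ∀ j, 0 < net.pow j)
    (hs0 : ∀ j, 0 < net.servingCoeff j) (hη0 : ∀ j, 0 < η j) {b : Σ j, ι j} {ω : Ω}
    (hX : X b.1 b.2 ω ≠ 0) (hI : net.interference X h b ω ≠ 0) :
    η b.1 < (net.sinr X h b ω).toReal ↔
      ∑' c : {c : Σ j, ι j // c ≠ b}, ENNReal.ofReal (net.relativePower η b.1 c.1.1 *
        ‖X b.1 b.2 ω‖ ^ net.α * ‖X c.1.1 c.1.2 ω‖ ^ (-net.α) * h c.1.1 c.1.2 ω)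
      < ENNReal.ofReal (h b.1 b.2 ω) := by
  have hr : 0 < ‖X b.1 b.2 ω‖ := norm_pos_iff.2 hX
  have hP := hpow b.1
  have hs := hs0 b.1
  have hη := hη0 b.1
  -- The factor that isolates the gain of $b$: signal over $\eta$ exceeds the interference $I$
  -- exactly when the gain exceeds $tI$.
  set t := η b.1 * ‖X b.1 b.2 ω‖ ^ net.α / (net.servingCoeff b.1 * net.pow b.1) with ht
  have ht0 : 0 < t := by positivity
  have hsum : ∑' c : {c : Σ j, ι j // c ≠ b}, ENNReal.ofReal (net.relativePower η b.1 c.1.1 *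
        ‖X b.1 b.2 ω‖ ^ net.α * ‖X c.1.1 c.1.2 ω‖ ^ (-net.α) * h c.1.1 c.1.2 ω)
      = ENNReal.ofReal t * net.interference X h b ω := by
    rw [interference, ← ENNReal.tsum_mul_left]
    refine tsum_congr fun c => ?_
    rw [← ENNReal.ofReal_mul ht0.le]
    congr 1
    rw [received, relativePower, ht]
    ring
  have hnum : net.servingCoeff b.1 * net.received X h b ω = η b.1 / t * h b.1 b.2 ω := by
    rw [received, ht, Real.rpow_neg hr.le]
    field_simp
  have hsinr : net.sinr X h b ω
      = ENNReal.ofReal (η b.1 / t * h b.1 b.2 ω) / net.interference X h b ω := by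
    rw [sinr, hnum, hnoise, ENNReal.ofReal_zero, add_zero]
  have hne : net.sinr X h b ω ≠ ∞ := by
    rw [hsinr]; exact ENNReal.div_ne_top ENNReal.ofReal_ne_top hI
  have hq : 0 < η b.1 / t := by positivity
  have hqt : ENNReal.ofReal (η b.1) * net.interference X h b ω
      = ENNReal.ofReal (η b.1 / t) * (ENNReal.ofReal t * net.interference X h b ω) := by
    rw [← mul_assoc, ← ENNReal.ofReal_mul hq.le, div_mul_cancel₀ _ ht0.ne']
  rw [← ENNReal.ofReal_lt_iff_lt_toReal hη.le hne, hsinr,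
    ENNReal.lt_div_iff_mul_lt (Or.inl hI) (Or.inr (ENNReal.ofReal_pos.2 hη).ne'), hqt, hsum,
    ENNReal.ofReal_mul hq.le,
    ENNReal.mul_lt_mul_iff_right (ENNReal.ofReal_pos.2 hq).ne' ENNReal.ofReal_ne_top]

end Success

/-! ### Measurability and almost sure positivity. -/

section Probability

variable {Ω : Type*} [MeasurableSpace Ω] {μ : Measure Ω} {ι : Tier → Type*} [∀ j, Countable (ι j)]
  {X : (j : Tier) → ι j → Ω → Plane} {h : (j : Tier) → ι j → Ω → ℝ} {η : Tier → ℝ}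

lemma measurable_sinr (hmodel : net.IsModel X h μ) (b : Σ j, ι j) :
    Measurable (net.sinr X h b) := by
  have hr : ∀ c, Measurable (net.received X h c) := fun c => by
    have h1 := (hmodel.poisson c.1).measurable c.2
    have h2 := hmodel.measurable_gain c.1 c.2
    unfold received
    fun_prop
  refine Measurable.div (by have := hr b; fun_prop) (Measurable.add ?_ measurable_const)
  exact Measurable.tsum fun c => by have := hr c; fun_prop

lemma measurableSet_threshold_lt (hmodel : net.IsModel X h μ) (b : Σ j, ι j) :
    MeasurableSet {ω | η b.1 < (net.sinr X h b ω).toReal} :=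
  measurableSet_lt measurable_const (measurable_sinr hmodel b).ennreal_toReal

end Probability

end FRAN

namespace FRAN

lemma C_pos {net : FRAN} (hα : 2 < net.α) : 0 < net.C := by
  have h1 : 0 < 2 * Real.pi / net.α := by positivity
  refine div_pos h1 (Real.sin_pos_of_pos_of_lt_pi h1 ?_)
  rw [div_lt_iff₀ (by linarith)]
  nlinarith [Real.pi_pos]

/-- The RRH term carries the positivity, since one of the F-AP tiers may have density 0. -/
lemma sum_lam_mul_rpow_pos {net : FRAN} (hlam : ∀ j, 0 ≤ net.lam j) (hlamR : 0 < net.lamR)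
    (hpow : ∀ j, 0 < net.pow j) (j : Tier) (q : ℝ) :
    0 < ∑ i, net.lam i * (net.interferenceCoeff j i * net.pow i) ^ q := by
  have hip : ∀ i, 0 < net.interferenceCoeff j i * net.pow i := fun i =>
    mul_pos (interferenceCoeff_pos j i) (hpow i)
  exact Finset.sum_pos' (fun i _ => mul_nonneg (hlam i) (Real.rpow_nonneg (hip i).le _))
    ⟨.R, Finset.mem_univ _, mul_pos hlamR (Real.rpow_pos_of_pos (hip .R) _)⟩

lemma ae_gain_pos {Ω : Type*} [MeasurableSpace Ω] {μ : Measure Ω} {ι : Tier → Type*} {net : FRAN}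
    {X : (j : Tier) → ι j → Ω → Plane} {h : (j : Tier) → ι j → Ω → ℝ} (hmodel : net.IsModel X h μ)
    (b : Σ j, ι j) : ∀ᵐ ω ∂μ, 0 < h b.1 b.2 ω := by
  have h1 := ae_pos_expMeasure (r := 1)
  rw [← hmodel.law_gain b.1 b.2] at h1
  exact ae_of_ae_map (hmodel.measurable_gain b.1 b.2).aemeasurable h1

/-- Some RRH other than $b$ has, almost surely, a positive gain and a location off the origin. This
rules out a division by zero in the SINR. -/
lemma ae_interference_ne_zero {Ω : Type*} [MeasurableSpace Ω] {μ : Measure Ω}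
    [IsProbabilityMeasure μ] {ι : Tier → Type*} {net : FRAN} {X : (j : Tier) → ι j → Ω → Plane}
    {h : (j : Tier) → ι j → Ω → ℝ} (hmodel : net.IsModel X h μ) (hlamR : 0 < net.lamR)
    (hpow : ∀ j, 0 < net.pow j) (b : Σ j, ι j) : ∀ᵐ ω ∂μ, net.interference X h b ω ≠ 0 := by
  have := (hmodel.poisson .R).nontrivial hlamR
  obtain ⟨m, hm⟩ : ∃ m : ι .R, (⟨.R, m⟩ : Σ j, ι j) ≠ b := by
    obtain ⟨m, m', hne⟩ := exists_pair_ne (ι .R)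
    by_cases hm : (⟨.R, m⟩ : Σ j, ι j) = b
    · refine ⟨m', fun hm' => hne ?_⟩
      have := hm.trans hm'.symm
      simpa using this
    · exact ⟨m, hm⟩
  filter_upwards [(hmodel.poisson .R).ae_ne_zero m, ae_gain_pos hmodel ⟨.R, m⟩] with ω hX hh hI
  rw [interference, ENNReal.tsum_eq_zero] at hI
  have h1 := ENNReal.ofReal_eq_zero.1 (hI ⟨⟨.R, m⟩, hm⟩)
  have h2 := interferenceCoeff_pos (net := net) b.1 .R
  have h3 := hpow .R
  have h4 : 0 < ‖X .R m ω‖ := norm_pos_iff.2 hX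
  refine absurd h1 (not_le.2 ?_)
  simp only [received]
  positivity

/-! ### The success probability of a tier. -/

section SuccessProbability

variable {Ω : Type*} [MeasurableSpace Ω] {μ : Measure Ω} [IsProbabilityMeasure μ]
  {ι : Tier → Type*} [∀ j, Countable (ι j)] {net : FRAN}
  {X : (j : Tier) → ι j → Ω → Plane} {h : (j : Tier) → ι j → Ω → ℝ} {η : Tier → ℝ}

lemma measure_threshold_lt (hmodel : net.IsModel X h μ) (hlamR : 0 < net.lamR)
    (hnoise : net.noise = 0) (hpow : ∀ j, 0 < net.pow j)
    (hs0 : ∀ j, 0 < net.servingCoeff j) (hη0 : ∀ j, 0 < η j) (b : Σ j, ι j) :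
    μ {ω | η b.1 < (net.sinr X h b ω).toReal}
      = ∫⁻ ω, coverage X net.α (net.relativePower η b.1) b ‖X b.1 b.2 ω‖ ω ∂μ := by
  have hmX : Measurable fun ω (b : Σ j, ι j) => X b.1 b.2 ω :=
    measurable_pi_lambda _ fun c => (hmodel.poisson c.1).measurable c.2
  have h1 := measure_tsum_gain_lt_of_indepFun hmX
    (fun c => hmodel.measurable_gain c.1 c.2) (fun c => hmodel.law_gain c.1 c.2)
    hmodel.indep_gain hmodel.indep_gain_location
    (a := fun c x => net.relativePower η b.1 c.1 * ‖x b‖ ^ net.α * ‖x c‖ ^ (-net.α))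
    (fun c => by fun_prop) (fun c x => by
      have h2 := interferenceCoeff_pos (net := net) b.1 c.1
      have h3 := hpow c.1
      have h4 := hpow b.1
      have h5 := hs0 b.1
      have h6 := hη0 b.1
      unfold relativePower
      positivity) b
  refine Eq.trans (measure_congr ?_) h1
  filter_upwards [(hmodel.poisson b.1).ae_ne_zero b.2,
    ae_interference_ne_zero hmodel hlamR hpow b] with ω hX hI
  exact propext (threshold_lt_iff hnoise hpow hs0 hη0 hX hI)

/-- The probability that some base station of tier `j` exceeds the threshold of its tier. -/
theorem measure_iUnion_threshold_lt (hmodel : net.IsModel X h μ) (hlam : ∀ j, 0 ≤ net.lam j)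
    (hlamR : 0 < net.lamR) (hα : 2 < net.α) (hnoise : net.noise = 0)
    (hpow : ∀ j, 0 < net.pow j) (hs0 : ∀ j, 0 < net.servingCoeff j) (hη0 : ∀ j, 0 < η j)
    (huniq : ∀ (b c : Σ j, ι j) ω, η b.1 < (net.sinr X h b ω).toReal →
      η c.1 < (net.sinr X h c ω).toReal → b = c) (j : Tier) :
    μ.real (⋃ n, {ω | η j < (net.sinr X h ⟨j, n⟩ ω).toReal})
      = net.lam j * (net.servingCoeff j * net.pow j) ^ (2 / net.α) * η j ^ (-(2 / net.α)) /
        (net.C * ∑ i, net.lam i * (net.interferenceCoeff j i * net.pow i) ^ (2 / net.α)) := by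
  have hC := C_pos hα
  have hic := interferenceCoeff_pos (net := net) j
  have hη := hη0 j
  have hsP : 0 < net.servingCoeff j * net.pow j := mul_pos (hs0 j) (hpow j)
  have hip : ∀ i, 0 < net.interferenceCoeff j i * net.pow i := fun i => mul_pos (hic i) (hpow i)
  set W := ∑ i, net.lam i * (net.interferenceCoeff j i * net.pow i) ^ (2 / net.α) with hW
  have hWpos : 0 < W := sum_lam_mul_rpow_pos hlam hlamR hpow j _
  have ha : ∀ i, 0 < net.relativePower η j i := fun i =>
    div_pos (mul_pos hη (hip i)) hsP
  -- Threshold and serving power do not depend on $i$ and leave the sum as powers with exponent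
  -- $2/\alpha$.
  have hsum : ∑ i, net.lam i * net.relativePower η j i ^ (2 / net.α)
      = η j ^ (2 / net.α) * W / (net.servingCoeff j * net.pow j) ^ (2 / net.α) := by
    rw [hW, Finset.mul_sum, Finset.sum_div]
    refine Finset.sum_congr rfl fun i _ => ?_
    rw [relativePower, Real.div_rpow (mul_pos hη (hip i)).le hsP.le,
      Real.mul_rpow hη.le (hip i).le]
    ring
  have hk : 0 < Real.pi * net.C * ∑ i, net.lam i * net.relativePower η j i ^ (2 / net.α) := by
    rw [hsum]; positivity
  have hdisj : Pairwise (Function.onFun Disjoint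
      fun n => {ω | η j < (net.sinr X h ⟨j, n⟩ ω).toReal}) := by
    intro n m hnm
    refine Set.disjoint_left.2 fun ω hn hm => hnm ?_
    simpa using huniq ⟨j, n⟩ ⟨j, m⟩ ω hn hm
  have hmeas : μ (⋃ n, {ω | η j < (net.sinr X h ⟨j, n⟩ ω).toReal})
      = ENNReal.ofReal (net.lam j) * ENNReal.ofReal (Real.pi /
        (Real.pi * net.C * ∑ i, net.lam i * net.relativePower η j i ^ (2 / net.α))) := by
    -- Uniqueness turns the union into a sum, that is, into the expected number of qualifying
    -- stations.
    rw [measure_iUnion hdisj fun n => measurableSet_threshold_lt hmodel ⟨j, n⟩]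
    refine Eq.trans (tsum_congr fun n =>
      measure_threshold_lt hmodel hlamR hnoise hpow hs0 hη0 ⟨j, n⟩) ?_
    rw [← lintegral_tsum fun n => (measurable_coverage hmodel.poisson _ _ _
      ((hmodel.poisson j).measurable n).norm).aemeasurable]
    exact lintegral_tsum_coverage hmodel.poisson hmodel.indep_tiers hlam hα ha j hk rfl
  rw [measureReal_def, hmeas, ENNReal.toReal_mul, ENNReal.toReal_ofReal (hlam j),
    ENNReal.toReal_ofReal (by positivity), hsum, Real.rpow_neg hη.le]
  field_simp

end SuccessProbability

end FRAN

theorem corollary5 {Ω : Type*} [MeasurableSpace Ω] (μ : Measure Ω) [IsProbabilityMeasure μ]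
    {ι : Tier → Type*} [∀ j, Countable (ι j)]
    (net : FRAN) (X : (j : Tier) → ι j → Ω → Plane) (h : (j : Tier) → ι j → Ω → ℝ)
    (hmodel : net.IsModel X h μ)
    (hlamF : 0 < net.lamF) (hlamR : 0 < net.lamR)
    (hpHit0 : 0 ≤ net.pHit) (hpHit1 : net.pHit ≤ 1)
    (hpowF : 0 < net.powF) (hpowR : 0 < net.powR) (hα : 2 < net.α)
    (hNB : 2 ≤ net.NB) (hL : 0 < net.L)
    (hβ : ∀ j, net.linkLatency j < net.β j)
    -- the network is interference-limited
    (hnoise : net.noise = 0)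
    -- `rate` maps the SINR of a link to its rate; `η j` is the SINR threshold of tier `j`
    (rate : ℝ → ℝ) (hrate : StrictMonoOn rate (Set.Ici 0))
    (η : Tier → ℝ)
    (hη : ∀ j, rate (η j) = net.traffic j + net.L / (net.β j - net.linkLatency j))
    (hηFc : 1 < η .Fc) (hηFn : 1 < η .Fn) (hηR : net.ζ / net.υ < η .R) :
    0 < net.totalSuccessProb rate X h μ ∧
    (∀ j, net.assocProb rate X h μ j =
      net.successProb rate X h μ j / net.totalSuccessProb rate X h μ) ∧
    (∀ j, net.assocProb rate X h μ j =
      net.successProb rate X h μ j /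
        (net.successProb rate X h μ .Fc + net.successProb rate X h μ .Fn
          + net.successProb rate X h μ .R)) ∧
    net.successProb rate X h μ .Fc =
      net.lam .Fc * net.powF ^ (2 / net.α) * η .Fc ^ (-(2 / net.α)) /
        (net.C * (net.lam .Fc * net.powF ^ (2 / net.α) + net.lam .Fn * net.powF ^ (2 / net.α)
          + net.lam .R * net.powR ^ (2 / net.α))) ∧
    net.successProb rate X h μ .Fn =
      net.lam .Fn * net.powF ^ (2 / net.α) * η .Fn ^ (-(2 / net.α)) /
        (net.C * (net.lam .Fc * net.powF ^ (2 / net.α) + net.lam .Fn * net.powF ^ (2 / net.α)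
          + net.lam .R * net.powR ^ (2 / net.α))) ∧
    net.successProb rate X h μ .R =
      net.lam .R * (net.ζ * net.powR) ^ (2 / net.α) * η .R ^ (-(2 / net.α)) /
        (net.C * (net.lam .R * (net.υ * net.powR) ^ (2 / net.α)
          + (net.lam .Fc * net.powF ^ (2 / net.α) + net.lam .Fn * net.powF ^ (2 / net.α)))) := by
  have hpow := FRAN.pow_pos hpowF hpowR
  have hlam := FRAN.lam_nonneg hlamF hlamR hpHit0 hpHit1
  have hs0 := FRAN.servingCoeff_pos hNB
  have hη0 := FRAN.threshold_pos hNB hηFc hηFn hηR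
  have hs := FRAN.servingCoeff_lt hNB hηFc hηFn hηR
  have hd : ∀ (b : Σ j, ι j) ω, net.delay rate X h b ω < (net.β b.1 : EReal) ↔
      η b.1 < (net.sinr X h b ω).toReal := FRAN.delay_lt_iff hL hβ hrate hη hη0
  have huniq : ∀ (b c : Σ j, ι j) ω, η b.1 < (net.sinr X h b ω).toReal →
      η c.1 < (net.sinr X h c ω).toReal → b = c :=
    fun b c ω => FRAN.eq_of_threshold_lt hs hs0 hη0
  have hS : ∀ j, net.successProb rate X h μ j
      = net.lam j * (net.servingCoeff j * net.pow j) ^ (2 / net.α) * η j ^ (-(2 / net.α)) /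
        (net.C * ∑ i, net.lam i * (net.interferenceCoeff j i * net.pow i) ^ (2 / net.α)) :=
    fun j => by
      rw [FRAN.successProb, FRAN.successEvent_eq hd]
      exact FRAN.measure_iUnion_threshold_lt hmodel hlam hlamR hα hnoise hpow hs0 hη0 huniq j
  have htotal : net.totalSuccessProb rate X h μ = net.successProb rate X h μ .Fc
      + net.successProb rate X h μ .Fn + net.successProb rate X h μ .R := by
    have hdisj : Pairwise (Function.onFun Disjoint (net.successEvent rate X h)) := by
      intro i j hij
      refine Set.disjoint_left.2 fun ω hi hj => hij ?_
      rw [FRAN.successEvent_eq hd, Set.mem_iUnion] at hi hj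
      obtain ⟨n, hn⟩ := hi
      obtain ⟨m, hm⟩ := hj
      -- Uniqueness holds across tiers, so success events of different tiers are disjoint too.
      exact congrArg Sigma.fst (huniq ⟨i, n⟩ ⟨j, m⟩ ω hn hm)
    have hmeas : ∀ j, MeasurableSet (net.successEvent rate X h j) := fun j => by
      rw [FRAN.successEvent_eq hd]
      exact .iUnion fun n => FRAN.measurableSet_threshold_lt hmodel ⟨j, n⟩
    rw [FRAN.totalSuccessProb, measureReal_def, measure_iUnion hdisj hmeas, tsum_fintype,
      ENNReal.toReal_sum fun j _ => measure_ne_top μ _, Tier.sum_eq, add_assoc]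
    rfl
  have hA : ∀ j, net.assocProb rate X h μ j =
      net.successProb rate X h μ j / net.totalSuccessProb rate X h μ := fun j => by
    rw [FRAN.assocProb, FRAN.assocEvent_eq hd huniq, FRAN.successProb]
  -- The RRH tier alone makes the total positive, whatever the hit probability.
  have hpos : 0 < net.successProb rate X h μ .R := by
    rw [hS .R]
    have hsum := FRAN.sum_lam_mul_rpow_pos hlam hlamR hpow .R (2 / net.α)
    have h1 := FRAN.C_pos hα
    have h2 := hs0 .R
    have h3 := hpow .R
    have h4 := hη0 .R
    have h5 : 0 < net.lam .R := hlamR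
    positivity
  refine ⟨?_, hA, fun j => by rw [hA, htotal], ?_, ?_, ?_⟩
  · rw [htotal]
    have h1 : 0 ≤ net.successProb rate X h μ .Fc := measureReal_nonneg
    have h2 : 0 ≤ net.successProb rate X h μ .Fn := measureReal_nonneg
    linarith
  · rw [hS .Fc, Tier.sum_eq]
    simp only [FRAN.servingCoeff, FRAN.interferenceCoeff, FRAN.pow, one_mul, add_assoc]
  · rw [hS .Fn, Tier.sum_eq]
    simp only [FRAN.servingCoeff, FRAN.interferenceCoeff, FRAN.pow, one_mul, add_assoc]
  · rw [hS .R, Tier.sum_eq, ← add_assoc, add_comm _ (net.lam .R * _)]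
    simp only [FRAN.servingCoeff, FRAN.interferenceCoeff, FRAN.pow, one_mul]
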